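/- **Definitions.** A *system of curves* $\mathcal C$ on a closed connected oriented surface $\Sigma$ is a finite set of pairwise disjoint simple closed curves; $V(\mathcal C)$ is the set of connected components of $\Sigma$ cut along $\mathcal C$, and $G(\mathcal C)$ is the dual graph, with vertex set $V(\mathcal C)$ and one edge for each curve of $\mathcal C$, joining the components on its two sides (loops and multiple edges are allowed). $\mathcal C$ is *proper* if all elements of $V(\mathcal C)$ have genus $0$, and *reduced* if $|V(\mathcal C)|=1$ or no element of $V(\mathcal C)$ has genus $0$. Let $V^+(\mathcal C)$ be the set of elements of $V(\mathcal C)$ of positive genus. $\mathcal A(\mathcal C)$ is the set of subgraphs $T$ of $G(\mathcal C)$ such that: $T$ is a maximal tree of $G(\mathcal C)$ if $V^+(\mathcal C)=\emptyset$; otherwise $T$ contains all vertices of $G(\mathcal C)$ and each component of $T$ is a tree containing exactly one element of $V^+(\mathcal C)$. $E(T)$ denotes the edge set of $T$. For a Heegaard diagram $H=(\Sigma,\mathcal C',\mathcal C'')$ (two transverse systems, $\mathcal C'$ proper) let $\Gamma(H)$ be the graph on $\Sigma$ formed by all the curves. Its singular vertices are the points where a curve of $\mathcal C'$ meets a curve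 of $\mathcal C''$, $c(H)$ is their number, $\mathcal R(H)$ is the set of regions (components of the complement) of $\Gamma(H)$, and $n(R)$ is the number of distinct singular vertices in the closure of the region $R$. $H$ is *reduced* if both systems are reduced; $\mathrm{Rd}(H)$ is the set of reduced diagrams obtained by replacing each of the two systems by a subsystem that determines the same compression body. The modified complexity is $\widetilde c(H)=c(H)-\max\{n(R)\mid R\in\mathcal R(H)\}$ if $H$ is reduced, and $\widetilde c(H)=\min\{\widetilde c(H')\mid H'\in \mathrm{Rd}(H)\}$ otherwise. Let $a,b,c\ge 0$, $n\ge 1$, $r,s$ be integers with $d=2a+b+c>0$. The *Dunwoody diagram* is the planar graph drawn on the sphere with $n$ internal circles $C'_1,\dots,C'_n$ arranged cyclically around an upper region and $n$ external circles $C''_1,\dots,C''_n$ arranged correspondingly around a lower region (indices mod $n$, increasing counterclockwise around the upper region, as seen from outside the sphere), each with $d$ vertices numbered $0,\dots,d-1$, counterclockwise on $C'_i$ and clockwise on $C''_i$, vertex $0$ coming just after the upper, respectively lower, region. In this order the vertices of $C'_i$ are joined by $a$ parallel arcs to $C'_{i-1}$, by $b$ to $C''_{i-1}$, by $c$ to $C''_i$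 and by $a$ to $C'_{i+1}$; those of $C''_i$ are joined by $a$ arcs to $C''_{i-1}$, by $c$ to $C'_i$, by $b$ to $C'_{i+1}$ and by $a$ to $C''_{i+1}$. Remove the interiors of the circles and glue $C'_i$ to $C''_{i+s}$ so that vertex $k$ of $C'_i$ is identified with vertex $k+r$ (mod $d$) of $C''_{i+s}$, for all $i,k$. This gives the *closed Dunwoody diagram* $H(a,b,c,n,r,s)=(\Sigma_n,\mathcal C',\mathcal C'')$, where $\mathcal C'$ consists of the $n$ curves arising from the circles and $\mathcal C''$ of the curves arising from the arcs. **Theorem 7.** Let $H=H(a,b,c,n,r,s)=(\Sigma_n,\mathcal C',\mathcal C'')$ be a closed Dunwoody diagram and $d=2a+b+c$. For $\gamma\in\mathcal C''$ let $n(\gamma)$ be the number of singular vertices of $\Gamma(H)$ on $\gamma$. For $T\in\mathcal A(\mathcal C'')$ let $H_T=(\Sigma_n,\mathcal C',\mathcal C''\setminus E(T))$. Then $H_T\in\mathrm{Rd}(H)$ for every $T\in\mathcal A(\mathcal C'')$, and $$\widetilde c(H)=nd-\max\Bigl\{\,n(R)+\sum_{\gamma\in E(T)}n(\gamma)\ \Bigm|\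 T\in\mathcal A(\mathcal C''),\ R\in\mathcal R(H_T)\Bigr\}.$$ -/

import Mathlib

namespace Dunwoody

/-! ## Surfaces with two transverse families of curves -/

/-- A closed connected oriented surface `Σ` together with two finite families of simple closed
curves drawn on it, the curves of one family being pairwise disjoint and the two families meeting
transversally, given up to orientation preserving homeomorphism by the following finite data.

The union of all the curves is a graph embedded in `Σ`, whose vertices are all the intersection
points (4-valent) and some further points (2-valent). A *dart* is an oriented edge of that graph.
`rev` reverses a dart, `rot d` is the next dart after `d` in the counterclockwise order around the
initial vertex of `d`, `colour` tells to which of the two families a dart belongs.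
A *region* is a connected component of the complement of the graph. It need not be a disc: it is an
open orientable surface of genus `genus R`, with one end for each of its boundary cycles.
`left d` is the region on the left of `d`. -/
structure CurvedSurface where
  Dart : Type
  Region : Type
  finite_dart : Finite Dart
  finite_region : Finite Region
  nonempty_region : Nonempty Region
  rev : Equiv.Perm Dart
  rot : Equiv.Perm Dart
  colour : Dart → Bool
  left : Dart → Region
  genus : Region → ℕ
  rev_rev : ∀ d, rev (rev d) = d
  rev_ne : ∀ d, rev d ≠ d
  colour_rev : ∀ d, colour (rev d) = colour d
  /-- At each vertex either two darts of one colour start, or four darts of alternating colours. -/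
  valence : ∀ d,
    (rot d ≠ d ∧ rot (rot d) = d ∧ colour (rot d) = colour d) ∨
    (rot (rot d) ≠ d ∧ rot (rot (rot (rot d))) = d ∧
      colour (rot d) ≠ colour d ∧ colour (rot (rot d)) = colour d)
  /-- The corner between `d` and the next dart `rot d` lies on the left of `d` and on the right
  of `rot d`. -/
  left_rot : ∀ d, left (rev (rot d)) = left d
  /-- `Σ` is connected: any two regions are joined by a chain of regions that are adjacent along
  edges. -/
  connected : ∀ R R', Relation.EqvGen (fun x y => ∃ d, left d = x ∧ left (rev d) = y) R R'

namespace CurvedSurface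

variable (S : CurvedSurface)

instance : Finite S.Dart := S.finite_dart
instance : Finite S.Region := S.finite_region
instance : Nonempty S.Region := S.nonempty_region

/-- The dart starting at the same vertex as `d` and lying on the same curve. -/
def opp (d : S.Dart) : S.Dart :=
  if S.colour (S.rot d) = S.colour d then S.rot d else S.rot (S.rot d)

/-- Vertices: two darts with the same initial vertex differ by a power of `rot`. -/
def Vertex : Type := Quot fun d e : S.Dart => e = S.rot d

/-- Unoriented edges. -/
def Edge : Type := Quot fun d e : S.Dart => e = S.rev d

/-- The (unoriented) curves drawn on the surface: two darts lie on the same curve if one can be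
reached from the other by reversing darts and by going straight on at vertices. -/
def Curve : Type := Quot fun d e : S.Dart => e = S.rev d ∨ e = S.opp d

/-- The sides of the curves (equivalently, the oriented curves): follow a dart to its end and go
straight on. Every curve has two sides; a dart determines the side on its left. -/
def Side : Type := Quot fun d e : S.Dart => e = S.opp (S.rev d)

/-- The boundary cycles of the regions: `rev (rot d)` precedes `d` on the boundary of the region
on the left of `d`. -/
def BoundaryCycle : Type := Quot fun d e : S.Dart => e = S.rev (S.rot d)

def vertex (d : S.Dart) : S.Vertex := Quot.mk _ d
def edge (d : S.Dart) : S.Edge := Quot.mk _ d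
def curve (d : S.Dart) : S.Curve := Quot.mk _ d
def side (d : S.Dart) : S.Side := Quot.mk _ d
def boundaryCycle (d : S.Dart) : S.BoundaryCycle := Quot.mk _ d

/-- The connected components of the surface cut along a set `C` of curves: regions are merged
across the edges that do not lie on `C`. -/
def Piece (C : Set S.Curve) : Type :=
  Quot fun R R' : S.Region => ∃ d, S.curve d ∉ C ∧ S.left d = R ∧ S.left (S.rev d) = R'

/-- The component that contains a given region. -/
def piece (C : Set S.Curve) (R : S.Region) : S.Piece C := Quot.mk _ R

/-- The number of boundary cycles of a region. -/
noncomputable def boundaryCount (R : S.Region) : ℕ :=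
  (S.boundaryCycle '' {d | S.left d = R}).ncard

/-- The Euler characteristic of the closed surface obtained from the component `X` of the surface
cut along `C` by capping off all of its boundary circles with discs (where `C` consists of pairwise
disjoint curves): regions, minus the edges inside `X`, plus the vertices inside `X`, plus one disc
for each side of a curve of `C` that faces `X`. A region of genus `g` with `k` boundary cycles
contributes `2 - 2 g - k`. -/
noncomputable def cappedEuler (C : Set S.Curve) (X : S.Piece C) : ℤ :=
  (∑ᶠ R ∈ {R : S.Region | S.piece C R = X}, (2 - 2 * (S.genus R : ℤ) - (S.boundaryCount R : ℤ)))
  - ((S.edge '' {d | S.curve d ∉ C ∧ S.piece C (S.left d) = X}).ncard : ℤ)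
  + ((S.vertex '' {d | (∀ e, S.vertex e = S.vertex d → S.curve e ∉ C) ∧
        S.piece C (S.left d) = X}).ncard : ℤ)
  + ((S.side '' {d | S.curve d ∈ C ∧ S.piece C (S.left d) = X}).ncard : ℤ)

/-- The genus of a component of the surface cut along `C`. (The capped Euler characteristic is
`2 - 2 * genus`.) -/
noncomputable def pieceGenus (C : Set S.Curve) (X : S.Piece C) : ℤ :=
  (2 - S.cappedEuler C X) / 2

theorem curve_rev (d : S.Dart) : S.curve (S.rev d) = S.curve d :=
  (Quot.sound (r := fun d e : S.Dart => e = S.rev d ∨ e = S.opp d) (Or.inl rfl)).symm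

end CurvedSurface

/-! ## Systems of curves -/

/-- A system of (pairwise disjoint simple closed) curves on `S`: a set of curves of the family of
colour `i`. -/
structure CurveSystem (S : CurvedSurface) (i : Bool) where
  curves : Set S.Curve
  colour_eq : ∀ d, S.curve d ∈ curves → S.colour d = i

namespace CurveSystem

variable {S : CurvedSurface} {i : Bool}

/-- `V(C)`, the components of the surface cut along the system. -/
abbrev Piece (C : CurveSystem S i) : Type := S.Piece C.curves

/-- The genus of an element of `V(C)`. -/
noncomputable def genus (C : CurveSystem S i) (X : C.Piece) : ℤ := S.pieceGenus C.curves X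

/-- The system is proper if all elements of `V(C)` have genus zero. -/
def IsProper (C : CurveSystem S i) : Prop := ∀ X : C.Piece, C.genus X = 0

/-- The system is reduced if `V(C)` has one element, or has no elements of genus zero. -/
def IsReduced (C : CurveSystem S i) : Prop :=
  Nat.card C.Piece = 1 ∨ ∀ X : C.Piece, C.genus X ≠ 0

/-- `V⁺(C)`, the components of positive genus (the genus of a surface is never negative). -/
def positivePieces (C : CurveSystem S i) : Set C.Piece := {X | C.genus X ≠ 0}

/-- The number of components of genus `g` (`g ≠ 0`) of the negative boundary of the compression body
determined by `C`. Attaching 2-handles to `Σ × [0,1]` along `C` turns `Σ × {0}` into the disjoint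
union of the capped elements of `V(C)`, and the spheres among these are filled with balls. -/
noncomputable def negativeBoundaryCount (C : CurveSystem S i) (g : ℤ) : ℕ :=
  {X : C.Piece | C.genus X = g}.ncard

/-- Two systems on the same surface determine the same compression body. A compression body is
determined by its positive boundary, which is the given surface for both systems, and by the list of
the genera of the components of its negative boundary, which are all positive. -/
def SameCompressionBody (C D : CurveSystem S i) : Prop :=
  ∀ g : ℤ, g ≠ 0 → C.negativeBoundaryCount g = D.negativeBoundaryCount g

/-- The system obtained by removing the curves in `F`. -/
def remove (C : CurveSystem S i) (F : Set S.Curve) : CurveSystem S i where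
  curves := C.curves \ F
  colour_eq d hd := C.colour_eq d hd.1

theorem piece_opp (C : CurveSystem S i) {d : S.Dart} (hd : S.curve d ∈ C.curves) :
    S.piece C.curves (S.left (S.opp d)) = S.piece C.curves (S.left (S.rev d)) ∧
    S.piece C.curves (S.left (S.rev (S.opp d))) = S.piece C.curves (S.left d) := by
  have cross : ∀ e, S.colour e ≠ i →
      S.piece C.curves (S.left e) = S.piece C.curves (S.left (S.rev e)) := fun e he =>
    Quot.sound ⟨e, fun h => he (C.colour_eq e h), rfl, rfl⟩
  have hc := C.colour_eq d hd
  unfold CurvedSurface.opp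
  rcases S.valence d with ⟨_, h2, h3⟩ | ⟨_, h4, h5, h6⟩
  · rw [if_pos h3]
    have e1 := S.left_rot (S.rot d)
    rw [h2] at e1
    exact ⟨by rw [e1], by rw [S.left_rot d]⟩
  · rw [if_neg h5]
    have h7 : S.colour (S.rot (S.rot (S.rot d))) ≠ i := by
      rcases S.valence (S.rot d) with ⟨_, _, g3⟩ | ⟨_, _, _, g6⟩
      · exact absurd (g3.symm.trans h6) h5
      · rw [g6]; exact fun h => h5 (h.trans hc.symm)
    refine ⟨?_, ?_⟩
    · have e1 := S.left_rot (S.rot (S.rot (S.rot d)))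
      rw [h4] at e1
      rw [e1, cross _ h7, S.left_rot]
    · rw [S.left_rot, cross _ (fun h => h5 (h.trans hc.symm)), S.left_rot]

theorem pieces_of_curve_eq (C : CurveSystem S i) {d e : S.Dart} (hd : S.curve d ∈ C.curves)
    (h : S.curve d = S.curve e) :
    (S.piece C.curves (S.left d) = S.piece C.curves (S.left e) ∧
      S.piece C.curves (S.left (S.rev d)) = S.piece C.curves (S.left (S.rev e))) ∨
    (S.piece C.curves (S.left d) = S.piece C.curves (S.left (S.rev e)) ∧
      S.piece C.curves (S.left (S.rev d)) = S.piece C.curves (S.left e)) := by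
  have h' := Quot.eqvGen_exact h
  clear h
  induction h' with
  | rel x y hxy =>
    rcases hxy with rfl | rfl
    · right; exact ⟨by rw [S.rev_rev], rfl⟩
    · right; exact ⟨(C.piece_opp hd).2.symm, (C.piece_opp hd).1.symm⟩
  | refl x => exact Or.inl ⟨rfl, rfl⟩
  | symm x y hxy ih =>
    have hx : S.curve x ∈ C.curves := by
      rwa [show S.curve x = S.curve y from Quot.eqvGen_sound hxy]
    rcases ih hx with ⟨p, q⟩ | ⟨p, q⟩
    · exact Or.inl ⟨p.symm, q.symm⟩
    · exact Or.inr ⟨q.symm, p.symm⟩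
  | trans x y z hxy hyz ih1 ih2 =>
    have hy : S.curve y ∈ C.curves := by
      rwa [show S.curve y = S.curve x from (Quot.eqvGen_sound hxy).symm]
    rcases ih1 hd with ⟨p, q⟩ | ⟨p, q⟩ <;> rcases ih2 hy with ⟨p', q'⟩ | ⟨p', q'⟩
    · exact Or.inl ⟨p.trans p', q.trans q'⟩
    · exact Or.inr ⟨p.trans p', q.trans q'⟩
    · exact Or.inr ⟨p.trans q', q.trans p'⟩
    · exact Or.inl ⟨p.trans q', q.trans p'⟩

/-- `G(C)`, the graph dual to the system: its vertices are the elements of `V(C)`, its edges are the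
curves of `C`, and a curve joins the components on its two sides. Loops and multiple edges may
occur. -/
def dualGraph (C : CurveSystem S i) : Graph C.Piece S.Curve where
  vertexSet := Set.univ
  edgeSet := C.curves
  IsLink γ X Y := γ ∈ C.curves ∧ ∃ d, S.curve d = γ ∧
    S.piece C.curves (S.left d) = X ∧ S.piece C.curves (S.left (S.rev d)) = Y
  isLink_symm := by
    refine fun γ _ => ⟨?_⟩
    rintro X Y ⟨h, d, hd, hX, hY⟩
    exact ⟨h, S.rev d, by rw [S.curve_rev, hd], hY, by rw [S.rev_rev, hX]⟩
  eq_or_eq_of_isLink_of_isLink := by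
    rintro γ X Y Z W ⟨h, d, rfl, rfl, rfl⟩ ⟨-, e, he, rfl, rfl⟩
    rcases C.pieces_of_curve_eq h he.symm with ⟨p, _⟩ | ⟨p, _⟩
    · exact Or.inl p
    · exact Or.inr p
  edge_mem_iff_exists_isLink := by
    intro γ
    constructor
    · intro h
      induction γ using Quot.ind with
      | mk d => exact ⟨_, _, h, d, rfl, rfl, rfl⟩
    · rintro ⟨_, _, h, _⟩
      exact h
  left_mem_of_isLink := fun _ _ _ _ => Set.mem_univ _

end CurveSystem

/-! ## Trees in multigraphs, and the graphs along which a system is reduced -/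

section Graphs

variable {α β : Type}

/-- `x` and `y` are joined by a path in `G`. -/
def Joined (G : Graph α β) (x y : α) : Prop := Relation.ReflTransGen G.Adj x y

/-- `G` has no cycles (in particular no loops and no multiple edges): no edge joins two vertices that
remain joined after the edge has been deleted. -/
def IsForest (G : Graph α β) : Prop :=
  ∀ e x y, G.IsLink e x y → ¬ Joined (G.deleteEdges {e}) x y

/-- `G` is a tree: non-empty, connected and without cycles. -/
def IsTree (G : Graph α β) : Prop :=
  G.vertexSet.Nonempty ∧ (∀ x ∈ G.vertexSet, ∀ y ∈ G.vertexSet, Joined G x y) ∧ IsForest G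

end Graphs

/-- `𝒜(C)`: the subgraphs `T` of `G(C)` such that `T` is a maximal tree in `G(C)` if `V⁺(C)` is
empty, and otherwise `T` contains all the vertices of `G(C)` and each component of `T` is a tree
containing exactly one vertex of `V⁺(C)`. -/
def CurveSystem.reducingGraphs {S : CurvedSurface} {i : Bool} (C : CurveSystem S i) :
    Set (Graph C.Piece S.Curve) :=
  {T | T ≤ C.dualGraph ∧
    (C.positivePieces = ∅ → Maximal (fun T' => T' ≤ C.dualGraph ∧ IsTree T') T) ∧
    (C.positivePieces.Nonempty → T.vertexSet = C.dualGraph.vertexSet ∧ IsForest T ∧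
      ∀ X ∈ T.vertexSet, ∃! Y, Y ∈ C.positivePieces ∧ Joined T X Y)}

/-! ## Heegaard diagrams and their modified complexity -/

/-- A diagram `(Σ, C', C'')`: two transverse systems of curves on the surface `Σ` of `S`. It is a
Heegaard diagram if `C'` is proper. -/
structure Diagram (S : CurvedSurface) where
  fst : CurveSystem S true
  snd : CurveSystem S false

namespace Diagram

variable {S : CurvedSurface} (H : Diagram S)

/-- Both systems are reduced. -/
def IsReduced : Prop := H.fst.IsReduced ∧ H.snd.IsReduced

/-- The singular vertices of `Γ(H)`: the points where a curve of `C'` meets a curve of `C''`. -/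
def singularVertices : Set S.Vertex :=
  {v | ∃ d e, S.vertex d = v ∧ S.vertex e = v ∧
    S.curve d ∈ H.fst.curves ∧ S.curve e ∈ H.snd.curves}

/-- `c(H)`, the number of singular vertices of `Γ(H)`. -/
noncomputable def complexity : ℕ := H.singularVertices.ncard

/-- `ℛ(H)`, the regions of `Γ(H)`. -/
abbrev Region : Type := S.Piece (H.fst.curves ∪ H.snd.curves)

/-- `n(R)`, the number of singular vertices contained in the (closed) region `R`. -/
noncomputable def regionVertexCount (R : H.Region) : ℕ :=
  {v ∈ H.singularVertices | ∃ d, S.vertex d = v ∧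
    S.piece (H.fst.curves ∪ H.snd.curves) (S.left d) = R}.ncard

/-- `n(γ)`, the number of singular vertices contained in the curve `γ`. -/
noncomputable def curveVertexCount (γ : S.Curve) : ℕ :=
  {v ∈ H.singularVertices | ∃ d, S.vertex d = v ∧ S.curve d = γ}.ncard

/-- The modified complexity of a reduced diagram: `c(H) - max {n(R)}`. The set of regions is finite
and not empty. -/
noncomputable def reducedModifiedComplexity : ℤ :=
  (H.complexity : ℤ) - ((⨆ R : H.Region, H.regionVertexCount R : ℕ) : ℤ)

/-- `Rd(H)`: the reduced diagrams obtained from `H` by replacing each of the two systems of curves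
with a subsystem that determines the same compression body. -/
def Rd : Set (Diagram S) :=
  {H' | H'.fst.curves ⊆ H.fst.curves ∧ H'.snd.curves ⊆ H.snd.curves ∧
    H'.fst.SameCompressionBody H.fst ∧ H'.snd.SameCompressionBody H.snd ∧ H'.IsReduced}

open Classical in
/-- The modified complexity of a diagram: the minimum over `Rd(H)` if the diagram is not reduced. -/
noncomputable def modifiedComplexity : ℤ :=
  if H.IsReduced then H.reducedModifiedComplexity
  else sInf (reducedModifiedComplexity '' H.Rd)

/-- `H_T`, the diagram obtained by removing from `C''` the curves that are edges of `T`. -/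
def removeEdges (T : Graph H.snd.Piece S.Curve) : Diagram S where
  fst := H.fst
  snd := H.snd.remove T.edgeSet

end Diagram

/-! ## Closed Dunwoody diagrams

The planar diagram, drawn on the sphere, has `n` internal circles `C'_i` and `n` external circles
`C''_i` (indices mod `n`), each with `d = 2 a + b + c` vertices. These are numbered `0, …, d - 1`.
With the sphere seen from outside and the index `i` increasing counterclockwise around
the upper region, the numbers increase counterclockwise around `C'_i` and clockwise around `C''_i`.
In this order the vertices of `C'_i` are the ends of
* `a` arcs to `C'_{i-1}`, `b` arcs to `C''_{i-1}`, `c` arcs to `C''_i`, `a` arcs to `C'_{i+1}`,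

those of `C''_i` are the ends of
* `a` arcs to `C''_{i-1}`, `c` arcs to `C'_i`, `b` arcs to `C'_{i+1}`, `a` arcs to `C''_{i+1}`,

and vertex `0` comes just after the upper (for `C'_i`), the lower (for `C''_i`) region of the
diagram. Vertex `k` of `C'_i` is glued to vertex `k + r` of `C''_{i+s}`. -/

section Planar

variable (a b c n : ℕ)

/-- An end of an arc of the planar diagram: `(true, i, k)` is vertex `k` of `C'_i` and `(false, i, k)`
is vertex `k` of `C''_i`. -/
abbrev ArcEnd : Type := Bool × ZMod n × ZMod (2 * a + b + c)

/-- The other end of the arc. Parallel arcs are numbered in opposite orders by two internal circles,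
or by two external ones, and in the same order by an internal and an external one. -/
def otherEnd : ArcEnd a b c n → ArcEnd a b c n
  | (true, i, k) =>
    if k.val < a then (true, i - 1, ((2 * a + b + c - 1 - k.val : ℕ) : ZMod (2 * a + b + c)))
    else if k.val < a + b then (false, i - 1, ((k.val + c : ℕ) : ZMod (2 * a + b + c)))
    else if k.val < a + b + c then (false, i, ((k.val - b : ℕ) : ZMod (2 * a + b + c)))
    else (true, i + 1, ((2 * a + b + c - 1 - k.val : ℕ) : ZMod (2 * a + b + c)))
  | (false, i, k) =>
    if k.val < a then (false, i - 1, ((2 * a + b + c - 1 - k.val : ℕ) : ZMod (2 * a + b + c)))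
    else if k.val < a + c then (true, i, ((k.val + b : ℕ) : ZMod (2 * a + b + c)))
    else if k.val < a + b + c then (true, i + 1, ((k.val - c : ℕ) : ZMod (2 * a + b + c)))
    else (false, i + 1, ((2 * a + b + c - 1 - k.val : ℕ) : ZMod (2 * a + b + c)))

/-- Names for the regions of the planar diagram. Walk from the upper region to the lower
region, crossing first the `a` arcs from `C'_{i-1}` to `C'_i`, then the `b` arcs from `C'_i` to
`C''_{i-1}`, then the `a` arcs from `C''_{i-1}` to `C''_i`; the region reached after `j` crossings is
`meridian i j`. Then walk from `meridian i (a + b)`, crossing the `c` arcs from `C'_i` to `C''_i`;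
the region reached after `j` crossings is `transverse i j`, and this walk ends in
`meridian (i + 1) a`. -/
inductive RegionName : Type
  | meridian (i : ZMod n) (j : Fin (2 * a + b + 1))
  | transverse (i : ZMod n) (j : Fin (c + 1))

/-- The pairs of names that denote the same region. -/
inductive SameRegion : RegionName a b c n → RegionName a b c n → Prop
  | upper (i i' : ZMod n) : SameRegion (.meridian i 0) (.meridian i' 0)
  | lower (i i' : ZMod n) :
      SameRegion (.meridian i (Fin.last _)) (.meridian i' (Fin.last _))
  | start (i : ZMod n) : SameRegion (.transverse i 0) (.meridian i ⟨a + b, by omega⟩)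
  | finish (i : ZMod n) :
      SameRegion (.transverse i (Fin.last _)) (.meridian (i + 1) ⟨a, by omega⟩)

/-- The regions of the planar diagram. If some of `a`, `b`, `c` vanish, the diagram may be
disconnected and its regions need not be discs. -/
def PlanarRegion : Type := Quot (SameRegion a b c n)

variable {n}

def meridianRegion (i : ZMod n) (j : ℕ) (hj : j ≤ 2 * a + b) : PlanarRegion a b c n :=
  Quot.mk _ (.meridian i ⟨j, by omega⟩)

def transverseRegion (i : ZMod n) (j : ℕ) (hj : j ≤ c) : PlanarRegion a b c n :=
  Quot.mk _ (.transverse i ⟨j, by omega⟩)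

/-- The region that touches `C'_i` (if `t` is `true`) or `C''_i` (if `t` is `false`) between
the vertices `k - 1` and `k`, for `0 ≤ k ≤ d` (where vertices `-1` and `d` are `d - 1` and `0`). -/
def gapNat (t : Bool) (i : ZMod n) (k : ℕ) (hk : k ≤ 2 * a + b + c) : PlanarRegion a b c n :=
  match t with
  | true =>
    if h₁ : k ≤ a + b then meridianRegion a b c i k (by omega)
    else if h₂ : k ≤ a + b + c then transverseRegion a b c i (k - (a + b)) (by omega)
    else meridianRegion a b c (i + 1) (2 * a + b + c - k) (by omega)
  | false =>
    if h₁ : k ≤ a then meridianRegion a b c i (2 * a + b - k) (by omega)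
    else if h₂ : k ≤ a + c then transverseRegion a b c i (k - a) (by omega)
    else meridianRegion a b c (i + 1) (k - c) (by omega)

variable {a b c}

/-- The region on the left of an arc that is travelled starting at the given end. -/
def endLeft (hd : 0 < 2 * a + b + c) (e : ArcEnd a b c n) : PlanarRegion a b c n :=
  haveI : NeZero (2 * a + b + c) := ⟨hd.ne'⟩
  match e with
  | (true, i, k) => gapNat a b c true i (k.val + 1) (ZMod.val_lt k)
  | (false, i, k) => gapNat a b c false i k.val (ZMod.val_lt k).le

/-- The region on the right of an arc that is travelled starting at the given end. -/
def endRight (hd : 0 < 2 * a + b + c) (e : ArcEnd a b c n) : PlanarRegion a b c n :=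
  haveI : NeZero (2 * a + b + c) := ⟨hd.ne'⟩
  match e with
  | (true, i, k) => gapNat a b c true i k.val (ZMod.val_lt k).le
  | (false, i, k) => gapNat a b c false i (k.val + 1) (ZMod.val_lt k)

theorem otherEnd_otherEnd (hd : 0 < 2 * a + b + c) (e : ArcEnd a b c n) :
    otherEnd a b c n (otherEnd a b c n e) = e := by
  have : NeZero (2 * a + b + c) := ⟨hd.ne'⟩
  obtain ⟨t, i, k⟩ := e
  have hk := ZMod.val_lt k
  have key : ∀ m : ℕ, m = k.val → ((m : ℕ) : ZMod (2 * a + b + c)) = k := by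
    rintro m rfl; exact ZMod.natCast_zmod_val k
  cases t
  · by_cases h1 : k.val < a
    · simp only [otherEnd, h1, if_true]
      rw [ZMod.val_cast_of_lt (by omega), if_neg (by omega), if_neg (by omega), if_neg (by omega),
        key _ (by omega), sub_add_cancel]
    by_cases h2 : k.val < a + c
    · simp only [otherEnd, h1, h2, if_true, if_false]
      rw [ZMod.val_cast_of_lt (by omega), if_neg (by omega), if_neg (by omega), if_pos (by omega),
        key _ (by omega)]
    by_cases h3 : k.val < a + b + c
    · simp only [otherEnd, h1, h2, h3, if_true, if_false]
      rw [ZMod.val_cast_of_lt (by omega), if_neg (by omega), if_pos (by omega),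
        key _ (by omega), add_sub_cancel_right]
    · simp only [otherEnd, h1, h2, h3, if_false]
      rw [ZMod.val_cast_of_lt (by omega), if_pos (by omega), key _ (by omega),
        add_sub_cancel_right]
  · by_cases h1 : k.val < a
    · simp only [otherEnd, h1, if_true]
      rw [ZMod.val_cast_of_lt (by omega), if_neg (by omega), if_neg (by omega), if_neg (by omega),
        key _ (by omega), sub_add_cancel]
    by_cases h2 : k.val < a + b
    · simp only [otherEnd, h1, h2, if_true, if_false]
      rw [ZMod.val_cast_of_lt (by omega), if_neg (by omega), if_neg (by omega), if_pos (by omega),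
        key _ (by omega), sub_add_cancel]
    by_cases h3 : k.val < a + b + c
    · simp only [otherEnd, h1, h2, h3, if_true, if_false]
      rw [ZMod.val_cast_of_lt (by omega), if_neg (by omega), if_pos (by omega),
        key _ (by omega)]
    · simp only [otherEnd, h1, h2, h3, if_false]
      rw [ZMod.val_cast_of_lt (by omega), if_pos (by omega), key _ (by omega),
        add_sub_cancel_right]

theorem otherEnd_ne (hd : 0 < 2 * a + b + c) (e : ArcEnd a b c n) :
    otherEnd a b c n e ≠ e := by
  have : NeZero (2 * a + b + c) := ⟨hd.ne'⟩
  obtain ⟨t, i, k⟩ := e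
  have hk := ZMod.val_lt k
  have key : ∀ m : ℕ, m < 2 * a + b + c → ((m : ℕ) : ZMod (2 * a + b + c)) = k → m = k.val := by
    rintro m hm rfl; exact (ZMod.val_cast_of_lt hm).symm
  intro h
  cases t
  · simp only [otherEnd] at h
    split_ifs at h with h1 h2 h3
    · have := key _ (by omega) (congrArg (fun x => x.2.2) h); omega
    · exact absurd (congrArg Prod.fst h) (by simp)
    · exact absurd (congrArg Prod.fst h) (by simp)
    · have := key _ (by omega) (congrArg (fun x => x.2.2) h); omega
  · simp only [otherEnd] at h
    split_ifs at h with h1 h2 h3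
    · have := key _ (by omega) (congrArg (fun x => x.2.2) h); omega
    · exact absurd (congrArg Prod.fst h) (by simp)
    · exact absurd (congrArg Prod.fst h) (by simp)
    · have := key _ (by omega) (congrArg (fun x => x.2.2) h); omega

theorem meridian_congr {i i' : ZMod n} {j j' : ℕ} {hj : j ≤ 2 * a + b} {hj' : j' ≤ 2 * a + b}
    (hi : i = i') (h : j = j') : meridianRegion a b c i j hj = meridianRegion a b c i' j' hj' := by
  subst hi h; rfl

theorem transverse_congr {i : ZMod n} {j j' : ℕ} {hj : j ≤ c} {hj' : j' ≤ c}
    (h : j = j') : transverseRegion a b c i j hj = transverseRegion a b c i j' hj' := by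
  subst h; rfl

theorem gapNat_congr {t : Bool} {i : ZMod n} {k k' : ℕ} {hk : k ≤ 2 * a + b + c}
    {hk' : k' ≤ 2 * a + b + c} (h : k = k') : gapNat a b c t i k hk = gapNat a b c t i k' hk' := by
  subst h; rfl

theorem meridian_zero {i i' : ZMod n} {j j' : ℕ} {hj : j ≤ 2 * a + b} {hj' : j' ≤ 2 * a + b}
    (h : j = 0) (h' : j' = 0) : meridianRegion a b c i j hj = meridianRegion a b c i' j' hj' := by
  subst h h'; exact Quot.sound (.upper i i')

theorem meridian_last {i i' : ZMod n} {j j' : ℕ} {hj : j ≤ 2 * a + b} {hj' : j' ≤ 2 * a + b}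
    (h : j = 2 * a + b) (h' : j' = 2 * a + b) :
    meridianRegion a b c i j hj = meridianRegion a b c i' j' hj' := by
  subst h h'; exact Quot.sound (.lower i i')

theorem transverse_zero {i : ZMod n} {j j' : ℕ} {hj : j ≤ c} {hj' : j' ≤ 2 * a + b}
    (h : j = 0) (h' : j' = a + b) :
    transverseRegion a b c i j hj = meridianRegion a b c i j' hj' := by
  subst h h'; exact Quot.sound (.start i)

theorem transverse_last {i i' : ZMod n} {j j' : ℕ} {hj : j ≤ c} {hj' : j' ≤ 2 * a + b}
    (hi : i' = i + 1) (h : j = c) (h' : j' = a) :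
    transverseRegion a b c i j hj = meridianRegion a b c i' j' hj' := by
  subst hi h h'; exact Quot.sound (.finish i)

theorem gap_true_low {i : ZMod n} {k j : ℕ} {hk : k ≤ 2 * a + b + c} {hj : j ≤ 2 * a + b}
    (h : k ≤ a + b) (hjk : j = k) :
    gapNat a b c true i k hk = meridianRegion a b c i j hj := by
  simp only [gapNat, dif_pos h]
  exact meridian_congr rfl hjk.symm

theorem gap_true_mid {i : ZMod n} {k j : ℕ} {hk : k ≤ 2 * a + b + c} {hj : j ≤ c}
    (hjk : k = a + b + j) :
    gapNat a b c true i k hk = transverseRegion a b c i j hj := by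
  by_cases h1 : k ≤ a + b
  · exact (gap_true_low (hj := by omega) h1 rfl).trans (transverse_zero (by omega) (by omega)).symm
  · simp only [gapNat, dif_neg h1, dif_pos (show k ≤ a + b + c by omega)]
    exact transverse_congr (by omega)

theorem gap_true_high {i i' : ZMod n} {k j : ℕ} {hk : k ≤ 2 * a + b + c} {hj : j ≤ 2 * a + b}
    (hi : i' = i + 1) (h : a + b + c ≤ k) (hjk : j + k = 2 * a + b + c) :
    gapNat a b c true i k hk = meridianRegion a b c i' j hj := by
  by_cases h1 : k ≤ a + b + c
  · exact (gap_true_mid (j := c) (hj := le_rfl) (by omega)).trans (transverse_last hi rfl (by omega))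
  · simp only [gapNat, dif_neg (show ¬ k ≤ a + b by omega), dif_neg h1]
    exact meridian_congr hi.symm (by omega)

theorem gap_false_low {i : ZMod n} {k j : ℕ} {hk : k ≤ 2 * a + b + c} {hj : j ≤ 2 * a + b}
    (h : k ≤ a) (hjk : j + k = 2 * a + b) :
    gapNat a b c false i k hk = meridianRegion a b c i j hj := by
  simp only [gapNat, dif_pos h]
  exact meridian_congr rfl (by omega)

theorem gap_false_mid {i : ZMod n} {k j : ℕ} {hk : k ≤ 2 * a + b + c} {hj : j ≤ c}
    (hjk : k = a + j) :
    gapNat a b c false i k hk = transverseRegion a b c i j hj := by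
  by_cases h1 : k ≤ a
  · exact (gap_false_low (j := a + b) (hj := by omega) h1 (by omega)).trans
      (transverse_zero (by omega) rfl).symm
  · simp only [gapNat, dif_neg h1, dif_pos (show k ≤ a + c by omega)]
    exact transverse_congr (by omega)

theorem gap_false_high {i i' : ZMod n} {k j : ℕ} {hk : k ≤ 2 * a + b + c} {hj : j ≤ 2 * a + b}
    (hi : i' = i + 1) (h : a + c ≤ k) (hjk : k = j + c) :
    gapNat a b c false i k hk = meridianRegion a b c i' j hj := by
  by_cases h1 : k ≤ a + c
  · exact (gap_false_mid (j := c) (hj := le_rfl) (by omega)).trans (transverse_last hi rfl (by omega))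
  · simp only [gapNat, dif_neg (show ¬ k ≤ a by omega), dif_neg h1]
    exact meridian_congr hi.symm (by omega)

theorem gap_wrap {t : Bool} {i : ZMod n} {k k' : ℕ} {hk : k ≤ 2 * a + b + c}
    {hk' : k' ≤ 2 * a + b + c} (h : k = 2 * a + b + c) (h' : k' = 0) :
    gapNat a b c t i k hk = gapNat a b c t i k' hk' := by
  cases t
  · exact (gap_false_high (j := 2 * a + b) (hj := le_rfl) rfl (by omega) (by omega)).trans
      ((meridian_last rfl rfl).trans
        (gap_false_low (j := 2 * a + b) (hj := le_rfl) (by omega) (by omega)).symm)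
  · exact (gap_true_high (j := 0) (hj := by omega) rfl (by omega) (by omega)).trans
      ((meridian_zero rfl rfl).trans
        (gap_true_low (j := 0) (hj := by omega) (by omega) (by omega)).symm)

theorem gap_add_one [NeZero (2 * a + b + c)] (t : Bool) (i : ZMod n) (k : ZMod (2 * a + b + c)) :
    gapNat a b c t i (k + 1).val (ZMod.val_lt _).le =
      gapNat a b c t i (k.val + 1) (ZMod.val_lt k) := by
  have hk := ZMod.val_lt k
  have e : (k + 1) = ((k.val + 1 : ℕ) : ZMod (2 * a + b + c)) := by simp
  rcases Nat.lt_or_ge (k.val + 1) (2 * a + b + c) with h | h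
  · exact gapNat_congr (by rw [e, ZMod.val_cast_of_lt h])
  · have h0 : k.val + 1 = 2 * a + b + c := by omega
    exact (gap_wrap h0 (by rw [e, h0, ZMod.natCast_self, ZMod.val_zero])).symm

/-- The left and the right of an arc are exchanged when it is travelled from its other end. -/
theorem endLeft_otherEnd (hd : 0 < 2 * a + b + c) (e : ArcEnd a b c n) :
    endLeft hd (otherEnd a b c n e) = endRight hd e := by
  have : NeZero (2 * a + b + c) := ⟨hd.ne'⟩
  have cast : ∀ m : ℕ, m < 2 * a + b + c → ((m : ℕ) : ZMod (2 * a + b + c)).val = m :=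
    fun m hm => ZMod.val_cast_of_lt hm
  obtain ⟨t, i, k⟩ := e
  have hk := ZMod.val_lt k
  cases t
  · simp only [otherEnd, endRight]
    split_ifs with h1 h2 h3
    · have hv := cast (2 * a + b + c - 1 - k.val) (by omega)
      exact (gap_false_high (i' := i) (j := 2 * a + b - (k.val + 1)) (hk := (ZMod.val_lt _).le)
        (hj := by omega) (by ring) (by omega) (by omega)).trans (gap_false_low (by omega) (by omega)).symm
    · have hv := cast (k.val + b) (by omega)
      exact (gap_true_mid (hk := ZMod.val_lt _)
          (j := k.val + 1 - a) (hj := by omega) (by omega)).trans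
        (gap_false_mid (by omega)).symm
    · have hv := cast (k.val - c) (by omega)
      exact (gap_true_low (hk := ZMod.val_lt _)
          (j := k.val + 1 - c) (hj := by omega) (by omega) (by omega)).trans
        (gap_false_high rfl (by omega) (by omega)).symm
    · have hv := cast (2 * a + b + c - 1 - k.val) (by omega)
      exact (gap_false_low (hk := (ZMod.val_lt _).le)
          (j := k.val + 1 - c) (hj := by omega) (by omega) (by omega)).trans
        (gap_false_high rfl (by omega) (by omega)).symm
  · simp only [otherEnd, endRight]
    split_ifs with h1 h2 h3
    · have hv := cast (2 * a + b + c - 1 - k.val) (by omega)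
      exact (gap_true_high (hk := ZMod.val_lt _)
          (i' := i) (j := k.val) (hj := by omega) (by ring)
        (by omega) (by omega)).trans (gap_true_low (by omega) (by omega)).symm
    · have hv := cast (k.val + c) (by omega)
      exact (gap_false_high (hk := (ZMod.val_lt _).le)
          (i' := i) (j := k.val) (hj := by omega) (by ring)
        (by omega) (by omega)).trans (gap_true_low (by omega) (by omega)).symm
    · have hv := cast (k.val - b) (by omega)
      exact (gap_false_mid (hk := (ZMod.val_lt _).le)
          (j := k.val - b - a) (hj := by omega) (by omega)).trans
        (gap_true_mid (by omega)).symm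
    · have hv := cast (2 * a + b + c - 1 - k.val) (by omega)
      exact (gap_true_low (hk := ZMod.val_lt _)
          (j := 2 * a + b + c - k.val) (hj := by omega) (by omega)
        (by omega)).trans (gap_true_high rfl (by omega) (by omega)).symm

end Planar

/-- The four directions at a vertex of the closed diagram, in counterclockwise order. The vertex
`(i, k)` arises from vertex `k` of `C'_i` and vertex `k + r` of `C''_{i+s}`; `inner` is the arc ending
in the former, `outer` the arc ending in the latter, `next` and `prev` lead along the common circle to
the vertices `(i, k + 1)` and `(i, k - 1)`. -/
inductive Direction : Type
  | inner | next | outer | prev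

section Glued

variable (a b c n : ℕ) (r s : ℤ)

/-- The darts of the closed diagram. -/
abbrev DDart : Type := (ZMod n × ZMod (2 * a + b + c)) × Direction

instance : Finite Direction :=
  Finite.of_surjective (fun x : Bool × Bool => match x with
    | (true, true) => Direction.inner
    | (true, false) => Direction.next
    | (false, true) => Direction.outer
    | (false, false) => Direction.prev) (by
      rintro (_ | _ | _ | _)
      exacts [⟨(true, true), rfl⟩, ⟨(true, false), rfl⟩, ⟨(false, true), rfl⟩,
        ⟨(false, false), rfl⟩])

/-- The next direction counterclockwise. -/
def Direction.succ : Direction → Direction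
  | inner => next
  | next => outer
  | outer => prev
  | prev => inner

/-- The dart of the closed diagram that starts at an end of an arc. -/
def dartOfEnd : ArcEnd a b c n → DDart a b c n
  | (true, i, k) => ((i, k), .inner)
  | (false, i, k) => ((i - (s : ZMod n), k - (r : ZMod (2 * a + b + c))), .outer)

/-- The reversal of darts. -/
def dRev : DDart a b c n → DDart a b c n
  | ((i, k), .inner) => dartOfEnd a b c n r s (otherEnd a b c n (true, i, k))
  | ((i, k), .outer) => dartOfEnd a b c n r s
      (otherEnd a b c n (false, i + (s : ZMod n), k + (r : ZMod (2 * a + b + c))))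
  | ((i, k), .next) => ((i, k + 1), .prev)
  | ((i, k), .prev) => ((i, k - 1), .next)

/-- The rotation of darts. -/
def dRot : Equiv.Perm (DDart a b c n) where
  toFun x := (x.1, x.2.succ)
  invFun x := (x.1, x.2.succ.succ.succ)
  left_inv := by rintro ⟨p, _ | _ | _ | _⟩ <;> rfl
  right_inv := by rintro ⟨p, _ | _ | _ | _⟩ <;> rfl

/-- The circles have colour `true`, the arcs have colour `false`. -/
def dColour (x : DDart a b c n) : Bool :=
  match x.2 with
  | .inner => false
  | .next => true
  | .outer => false
  | .prev => true

variable {a b c n}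

/-- The region on the left of a dart. -/
def dLeft (hd : 0 < 2 * a + b + c) : DDart a b c n → PlanarRegion a b c n
  | ((i, k), .inner) => endLeft hd (true, i, k)
  | ((i, k), .outer) => endLeft hd (false, i + (s : ZMod n), k + (r : ZMod (2 * a + b + c)))
  | ((i, k), .prev) => endRight hd (true, i, k)
  | ((i, k), .next) => endRight hd (false, i + (s : ZMod n), k + (r : ZMod (2 * a + b + c)))

theorem dRev_dartOfEnd (e : ArcEnd a b c n) :
    dRev a b c n r s (dartOfEnd a b c n r s e) =
      dartOfEnd a b c n r s (otherEnd a b c n e) := by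
  obtain ⟨_ | _, i, k⟩ := e <;> simp [dartOfEnd, dRev]

theorem dRev_dRev (hd : 0 < 2 * a + b + c) (x : DDart a b c n) :
    dRev a b c n r s (dRev a b c n r s x) = x := by
  obtain ⟨⟨i, k⟩, _ | _ | _ | _⟩ := x
  · change dRev a b c n r s (dartOfEnd a b c n r s (otherEnd a b c n _)) = _
    rw [dRev_dartOfEnd, otherEnd_otherEnd hd]; rfl
  · simp [dRev]
  · change dRev a b c n r s (dartOfEnd a b c n r s (otherEnd a b c n _)) = _
    rw [dRev_dartOfEnd, otherEnd_otherEnd hd]; simp [dartOfEnd]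
  · simp [dRev]

theorem dColour_dartOfEnd (e : ArcEnd a b c n) :
    dColour a b c n (dartOfEnd a b c n r s e) = false := by
  obtain ⟨_ | _, i, k⟩ := e <;> rfl

theorem dartOfEnd_injective : Function.Injective (dartOfEnd a b c n r s) := by
  rintro ⟨_ | _, i, k⟩ ⟨_ | _, i', k'⟩ h <;> simp [dartOfEnd] at h ⊢ <;> exact h

theorem dRev_ne (hd : 0 < 2 * a + b + c) (x : DDart a b c n) : dRev a b c n r s x ≠ x := by
  obtain ⟨⟨i, k⟩, _ | _ | _ | _⟩ := x
  · intro h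
    exact otherEnd_ne hd (true, i, k) (dartOfEnd_injective r s h)
  · simp [dRev]
  · intro h
    refine otherEnd_ne hd (false, i + (s : ZMod n), k + (r : ZMod (2 * a + b + c)))
      (dartOfEnd_injective r s (h.trans ?_))
    simp [dartOfEnd]
  · simp [dRev]

theorem dLeft_dartOfEnd (hd : 0 < 2 * a + b + c) (e : ArcEnd a b c n) :
    dLeft r s hd (dartOfEnd a b c n r s e) = endLeft hd e := by
  obtain ⟨_ | _, i, k⟩ := e <;> simp [dartOfEnd, dLeft]

theorem dLeft_rot (hd : 0 < 2 * a + b + c) (x : DDart a b c n) :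
    dLeft r s hd (dRev a b c n r s (dRot a b c n x)) = dLeft r s hd x := by
  have : NeZero (2 * a + b + c) := ⟨hd.ne'⟩
  obtain ⟨⟨i, k⟩, _ | _ | _ | _⟩ := x
  · change endRight hd (true, i, k + 1) = endLeft hd (true, i, k)
    exact gap_add_one true i k
  · change dLeft r s hd (dartOfEnd a b c n r s (otherEnd a b c n _)) = _
    rw [dLeft_dartOfEnd, endLeft_otherEnd]; rfl
  · change endRight hd (false, i + (s : ZMod n), k - 1 + (r : ZMod (2 * a + b + c))) =
      endLeft hd (false, i + (s : ZMod n), k + (r : ZMod (2 * a + b + c)))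
    have h := gap_add_one false (i + (s : ZMod n)) (k - 1 + (r : ZMod (2 * a + b + c)))
    simp only [endRight, endLeft]
    rw [← h]
    exact gapNat_congr (congrArg ZMod.val (by ring))
  · change dLeft r s hd (dartOfEnd a b c n r s (otherEnd a b c n _)) = _
    rw [dLeft_dartOfEnd, endLeft_otherEnd]; rfl

/-- Two regions of the closed diagram are connected by crossing edges. -/
abbrev Linked (hd : 0 < 2 * a + b + c) : PlanarRegion a b c n → PlanarRegion a b c n → Prop :=
  Relation.EqvGen fun x y => ∃ d, dLeft r s hd d = x ∧ dLeft r s hd (dRev a b c n r s d) = y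

theorem linked_gap (hd : 0 < 2 * a + b + c) (t : Bool) (i : ZMod n) (k : ℕ)
    (hk : k ≤ 2 * a + b + c) :
    Linked r s hd (gapNat a b c t i 0 (by omega)) (gapNat a b c t i k hk) := by
  have : NeZero (2 * a + b + c) := ⟨hd.ne'⟩
  induction k with
  | zero => exact .refl _
  | succ k ih =>
    refine .trans _ _ _ (ih (by omega)) ?_
    have e1 : ((k : ℕ) : ZMod (2 * a + b + c)).val = k := ZMod.val_cast_of_lt (by omega)
    have step : ∀ e : ArcEnd a b c n, Linked r s hd (endLeft hd e) (endRight hd e) := fun e =>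
      .rel _ _ ⟨dartOfEnd a b c n r s e, dLeft_dartOfEnd r s hd e, by
        rw [dRev_dartOfEnd, dLeft_dartOfEnd, endLeft_otherEnd]⟩
    have h := step (t, i, (k : ZMod (2 * a + b + c)))
    have g1 : gapNat a b c t i _ (ZMod.val_lt (k : ZMod (2 * a + b + c))).le =
      gapNat a b c t i k (by omega) := gapNat_congr e1
    have g2 : gapNat a b c t i _ (ZMod.val_lt (k : ZMod (2 * a + b + c))) =
      gapNat a b c t i (k + 1) hk := gapNat_congr (by rw [e1])
    rw [← g1, ← g2]
    cases t
    · exact h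
    · exact .symm _ _ h

theorem linked_upper (hd : 0 < 2 * a + b + c) (i i' : ZMod n) (t : Bool) (k : ℕ)
    (hk : k ≤ 2 * a + b + c) :
    Linked r s hd (meridianRegion a b c i' 0 (by omega)) (gapNat a b c t i k hk) := by
  have : NeZero (2 * a + b + c) := ⟨hd.ne'⟩
  have up : ∀ (j : ZMod n) (l : ℕ) (hl : l ≤ 2 * a + b + c),
      Linked r s hd (meridianRegion a b c i' 0 (by omega)) (gapNat a b c true j l hl) := by
    intro j l hl
    have h := linked_gap r s hd true j l hl
    have e : gapNat a b c true j 0 (by omega) = meridianRegion a b c i' 0 (by omega) :=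
      (gap_true_low (j := 0) (hj := by omega) (by omega) rfl).trans (meridian_zero rfl rfl)
    rwa [e] at h
  cases t
  · have hr := (ZMod.val_lt (r : ZMod (2 * a + b + c))).le
    have h0 := linked_gap r s hd false i k hk
    have h1 := linked_gap r s hd false i _ hr
    have h2 : Linked r s hd (gapNat a b c true (i - (s : ZMod n)) (0 : ZMod (2 * a + b + c)).val
        (ZMod.val_lt _).le) (gapNat a b c false i _ hr) := by
      refine .rel _ _ ⟨((i - (s : ZMod n), 0), .prev), rfl, ?_⟩
      change gapNat a b c false (i - (s : ZMod n) + (s : ZMod n))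
        (((0 : ZMod (2 * a + b + c)) - 1 + (r : ZMod (2 * a + b + c))).val + 1) (ZMod.val_lt _) = _
      rw [sub_add_cancel, ← gap_add_one]
      exact gapNat_congr (congrArg ZMod.val (by ring))
    exact .trans _ _ _ (up _ _ _) (.trans _ _ _ h2 (.trans _ _ _ (.symm _ _ h1) h0))
  · exact up i k hk

theorem linked_all (hd : 0 < 2 * a + b + c) (R R' : PlanarRegion a b c n) :
    Linked r s hd R R' := by
  have main : ∀ R : PlanarRegion a b c n,
      Linked r s hd (meridianRegion a b c 0 0 (by omega)) R := by
    intro R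
    induction R using Quot.ind with
    | mk x =>
    cases x with
    | meridian i j =>
      have hj := j.2
      by_cases h : j.val ≤ a + b
      · have hl := linked_upper r s hd i 0 true j.val (by omega)
        rwa [gap_true_low (j := j.val) (hj := by omega) h rfl] at hl
      · have hl := linked_upper r s hd i 0 false (2 * a + b - j.val) (by omega)
        rwa [gap_false_low (j := j.val) (hj := by omega) (by omega) (by omega)] at hl
    | transverse i j =>
      have hj := j.2
      have hl := linked_upper r s hd i 0 true (a + b + j.val) (by omega)
      rwa [gap_true_mid (j := j.val) (hj := by omega) rfl] at hl
  exact .trans _ _ _ (.symm _ _ (main R)) (main R')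

end Glued

theorem finite_planarRegion (a b c n : ℕ) [NeZero n] : Finite (PlanarRegion a b c n) := by
  let f : (ZMod n × Fin (2 * a + b + 1)) ⊕ (ZMod n × Fin (c + 1)) → PlanarRegion a b c n :=
    fun x => Quot.mk _ (x.elim (fun y => .meridian y.1 y.2) fun y => .transverse y.1 y.2)
  refine Finite.of_surjective f fun R => ?_
  induction R using Quot.ind with
  | mk x =>
    cases x with
    | meridian i j => exact ⟨.inl (i, j), rfl⟩
    | transverse i j => exact ⟨.inr (i, j), rfl⟩

/-- The surface of the closed Dunwoody diagram, with all the curves that arise from the circles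
(colour `true`) and from the arcs (colour `false`). The interiors of the circles are removed from the
sphere before gluing, so the regions are those of the planar diagram; they have genus zero. -/
def closedSurface (a b c n : ℕ) (r s : ℤ) (hn : 0 < n) (hd : 0 < 2 * a + b + c) :
    CurvedSurface where
  Dart := DDart a b c n
  Region := PlanarRegion a b c n
  finite_dart := by
    have : NeZero n := ⟨hn.ne'⟩
    have : NeZero (2 * a + b + c) := ⟨hd.ne'⟩
    infer_instance
  finite_region := by
    have : NeZero n := ⟨hn.ne'⟩
    exact finite_planarRegion a b c n
  nonempty_region := ⟨meridianRegion a b c 0 0 (by omega)⟩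
  rev := ⟨dRev a b c n r s, dRev a b c n r s, dRev_dRev r s hd, dRev_dRev r s hd⟩
  rot := dRot a b c n
  colour := dColour a b c n
  left := dLeft r s hd
  genus _ := 0
  rev_rev := dRev_dRev r s hd
  rev_ne := dRev_ne r s hd
  colour_rev := by
    rintro ⟨⟨i, k⟩, _ | _ | _ | _⟩
    · exact dColour_dartOfEnd r s _
    · rfl
    · exact dColour_dartOfEnd r s _
    · rfl
  valence := by
    rintro ⟨p, _ | _ | _ | _⟩ <;> right <;>
      refine ⟨fun h => ?_, rfl, fun h => ?_, rfl⟩ <;>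
      first
      | exact absurd (congrArg Prod.snd h) (by simp [dRot, Direction.succ])
      | exact absurd h (by simp [dRot, dColour, Direction.succ])
  left_rot := dLeft_rot r s hd
  connected := linked_all r s hd

/-- The closed Dunwoody diagram `H(a,b,c,n,r,s) = (Σ_n, C', C'')`: `C'` consists of all the curves
arising from the circles, `C''` of all the curves arising from the arcs. -/
def closedDiagram (a b c n : ℕ) (r s : ℤ) (hn : 0 < n) (hd : 0 < 2 * a + b + c) :
    Diagram (closedSurface a b c n r s hn hd) where
  fst :=
    { curves := {γ | ∀ d, (closedSurface a b c n r s hn hd).curve d = γ →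
        (closedSurface a b c n r s hn hd).colour d = true}
      colour_eq := fun d hd' => hd' d rfl }
  snd :=
    { curves := {γ | ∀ d, (closedSurface a b c n r s hn hd).curve d = γ →
        (closedSurface a b c n r s hn hd).colour d = false}
      colour_eq := fun d hd' => hd' d rfl }

end Dunwoody

/-! Everything reduces to describing `Rd`. Cutting along the circles of a closed Dunwoody diagram
leaves a single component, the sphere with holes on which the arcs are drawn. So the first system is
reduced, and none of its curves can be dropped without changing the compression body. Only
subsystems of the second system `C` matter, and each of these is `C` with a set `F` of curves
removed.

Removing `F` merges the components of the cut surface along the edges in `F` of the dual graph. A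
curve has Euler characteristic zero, and uncutting it loses two capping discs. Hence the capped
Euler characteristic of a merged component is the sum of the old ones minus twice the number of
curves of `F` inside it. In terms of genera (`genus_merge`): the new genus is the sum of the old
genera plus the number of independent cycles of `F` in that component, called `excess`. Genus is
defined by integer division, so this needs the capped Euler characteristic to be even. That is a
parity argument with signs of permutations of darts (`even_cappedEuler`).

If the removal keeps the compression body, the total genus is unchanged; as excesses are nonnegative
they all vanish, so `F` is a forest. Genera then add up within its components, and reducedness
together with counting components of positive genus says that each component of `F` contains exactly
one of these, or that `F` is a spanning tree if there are none. Conversely every such `F` gives a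
reduced system with the same compression body. Hence `Rd` consists exactly of the diagrams obtained
by removing the edge sets of the graphs in `reducingGraphs` (`Rd_eq`).

Finally, each singular vertex lies on exactly one curve of the second system, so removing `F` lowers
the complexity by the sum of the vertex counts of its curves (`complexity_eq_add`). Minimising over
`Rd` becomes maximising the region count plus this sum, and the complexity of the full diagram is
the number of glued vertices. If the diagram is already reduced, `Rd` contains only the diagram
itself, so both branches of the definition of `modifiedComplexity` are covered. -/

namespace Dunwoody

/-! ## Sets of edges of a multigraph -/

section EdgeSets

variable {α β : Type*} (s t : β → α)

/-- `x` and `y` are joined by a path of edges in `F`, where the ends of `e` are `s e` and `t e`. -/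
def LinkedBy (F : Set β) : α → α → Prop :=
  Relation.EqvGen fun x y => ∃ e ∈ F, s e = x ∧ t e = y

/-- No edge of `F` joins two vertices that are joined by the other edges of `F`. -/
def Acyclic (F : Set β) : Prop := ∀ e ∈ F, ¬ LinkedBy s t (F \ {e}) (s e) (t e)

variable {s t} {F F' : Set β} {x y z : α} {e : β}

theorem LinkedBy.refl (x : α) : LinkedBy s t F x x := Relation.EqvGen.refl x

theorem LinkedBy.symm (h : LinkedBy s t F x y) : LinkedBy s t F y x := Relation.EqvGen.symm _ _ h

theorem LinkedBy.trans (h : LinkedBy s t F x y) (h' : LinkedBy s t F y z) : LinkedBy s t F x z :=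
  Relation.EqvGen.trans _ _ _ h h'

theorem linkedBy_comm : LinkedBy s t F x y ↔ LinkedBy s t F y x := ⟨.symm, .symm⟩

theorem LinkedBy.of_mem (h : e ∈ F) : LinkedBy s t F (s e) (t e) := .rel _ _ ⟨e, h, rfl, rfl⟩

theorem LinkedBy.mono (hF : F ⊆ F') (h : LinkedBy s t F x y) : LinkedBy s t F' x y :=
  Relation.EqvGen.mono (fun _ _ ⟨e, he, h⟩ => ⟨e, hF he, h⟩) _ _ h

theorem LinkedBy.congr_left (h : LinkedBy s t F x y) : LinkedBy s t F x z ↔ LinkedBy s t F y z :=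
  ⟨h.symm.trans, h.trans⟩

/-- A path can be shortened until it uses the new edge at most once, in one of its two directions.
-/
theorem linkedBy_insert :
    LinkedBy s t (insert e F) x y ↔ LinkedBy s t F x y ∨
      (LinkedBy s t F x (s e) ∧ LinkedBy s t F (t e) y) ∨
      (LinkedBy s t F x (t e) ∧ LinkedBy s t F (s e) y) := by
  constructor
  · intro h
    induction h with
    | rel x y h =>
      obtain ⟨f, rfl | hf, rfl, rfl⟩ := h
      · exact .inr (.inl ⟨.refl _, .refl _⟩)
      · exact .inl (.of_mem hf)
    | refl x => exact .inl (.refl _)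
    | symm x y _ ih =>
      rcases ih with h | ⟨h, h'⟩ | ⟨h, h'⟩
      · exact .inl h.symm
      · exact .inr (.inr ⟨h'.symm, h.symm⟩)
      · exact .inr (.inl ⟨h'.symm, h.symm⟩)
    | trans x y z _ _ ih ih' =>
      rcases ih with h | ⟨h, h'⟩ | ⟨h, h'⟩ <;> rcases ih' with g | ⟨g, g'⟩ | ⟨g, g'⟩
      · exact .inl (h.trans g)
      · exact .inr (.inl ⟨h.trans g, g'⟩)
      · exact .inr (.inr ⟨h.trans g, g'⟩)
      · exact .inr (.inl ⟨h, h'.trans g⟩)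
      · exact .inr (.inl ⟨h, g'⟩)
      · exact .inl (h.trans g')
      · exact .inr (.inr ⟨h, h'.trans g⟩)
      · exact .inl (h.trans g')
      · exact .inr (.inr ⟨h, g'⟩)
  · have m : ∀ {x y}, LinkedBy s t F x y → LinkedBy s t (insert e F) x y :=
      fun h => h.mono (Set.subset_insert _ _)
    have l : LinkedBy s t (insert e F) (s e) (t e) := .of_mem (Set.mem_insert _ _)
    rintro (h | ⟨h, h'⟩ | ⟨h, h'⟩)
    · exact m h
    · exact (m h).trans (l.trans (m h'))
    · exact (m h).trans (l.symm.trans (m h'))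

theorem Acyclic.mono (hF : F ⊆ F') (h : Acyclic s t F') : Acyclic s t F :=
  fun e he h' => h e (hF he) (h'.mono (Set.sdiff_subset_sdiff_left hF))

theorem acyclic_empty : Acyclic s t ∅ := fun _ h => h.elim

/-- A cycle through an old edge that uses `e` could be reopened at `e`: the rest of it would join
the ends of `e` inside `F`. -/
theorem Acyclic.insert (h : Acyclic s t F) (he : ¬ LinkedBy s t F (s e) (t e)) :
    Acyclic s t (insert e F) := by
  intro f hf hl
  by_cases hfe : f = e
  · subst hfe
    exact he (hl.mono (by intro g hg; exact hg.1.resolve_left hg.2))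
  have hfF : f ∈ F := hf.resolve_left hfe
  have hsub : F \ {f} ⊆ F := Set.sdiff_subset
  rw [Set.insert_sdiff_of_notMem _ (by simpa using Ne.symm hfe), linkedBy_insert] at hl
  rcases hl with hl | ⟨h1, h2⟩ | ⟨h1, h2⟩
  · exact h f hfF hl
  · exact he ((h1.mono hsub).symm.trans ((LinkedBy.of_mem hfF).trans (h2.mono hsub).symm))
  · exact he ((h2.mono hsub).trans ((LinkedBy.of_mem hfF).symm.trans (h1.mono hsub)))

/-! ### Cycle rank of the components of a multigraph -/

variable (s t)

/-- The number of independent cycles in the component of `x`. -/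
noncomputable def excess (F : Set β) (x : α) : ℤ :=
  ({e ∈ F | LinkedBy s t F x (s e)}.ncard : ℤ) + 1 - ({y | LinkedBy s t F x y}.ncard : ℤ)

variable {s t}

theorem excess_empty (x : α) : excess s t ∅ x = 0 := by
  have h2 : {y | LinkedBy s t (∅ : Set β) x y} = {x} := by
    ext y
    constructor
    · intro h
      change LinkedBy s t ∅ x y at h
      change y = x
      induction h with
      | rel x y h => exact h.elim fun _ h => h.1.elim
      | refl x => rfl
      | symm x y _ ih => exact ih.symm
      | trans x y z _ _ ih ih' => exact ih'.trans ih
    · rintro rfl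
      exact .refl _
  simp [excess, h2]

theorem excess_congr (h : LinkedBy s t F x y) : excess s t F x = excess s t F y := by
  simp only [excess, h.congr_left]

/-- An edge within one component closes a cycle: one more edge, the same vertices. -/
theorem excess_insert_of_linkedBy [Finite β] (he : e ∉ F) (h : LinkedBy s t F (s e) (t e))
    (hx : LinkedBy s t F x (s e)) : excess s t (insert e F) x = excess s t F x + 1 := by
  have hl : ∀ x y, LinkedBy s t (insert e F) x y ↔ LinkedBy s t F x y := by
    intro x y
    rw [linkedBy_insert]
    refine ⟨?_, .inl⟩
    rintro (h' | ⟨h1, h2⟩ | ⟨h1, h2⟩)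
    · exact h'
    · exact h1.trans (h.trans h2)
    · exact h1.trans (h.symm.trans h2)
  have h1 : {f ∈ insert e F | LinkedBy s t F x (s f)} =
      insert e {f ∈ F | LinkedBy s t F x (s f)} := by
    ext f
    simp only [Set.mem_ofPred_eq, Set.mem_insert_iff]
    constructor
    · rintro ⟨rfl | h, h'⟩
      exacts [.inl rfl, .inr ⟨h, h'⟩]
    · rintro (rfl | h)
      exacts [⟨.inl rfl, hx⟩, ⟨.inr h.1, h.2⟩]
  simp only [excess, hl, h1]
  rw [Set.ncard_insert_of_notMem (fun h => he h.1)]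
  push_cast; ring

/-- When two components are joined by a bridge, the new edge supplies the second `+ 1`, so cycle
ranks add. -/
theorem excess_insert_of_not_linkedBy_left [Finite α] [Finite β] (h : ¬ LinkedBy s t F (s e) (t e))
    (hx : LinkedBy s t F x (s e)) :
    excess s t (insert e F) x = excess s t F (s e) + excess s t F (t e) := by
  have he : e ∉ F := fun he => h (.of_mem he)
  have hl : ∀ y, LinkedBy s t (insert e F) x y ↔
      LinkedBy s t F (s e) y ∨ LinkedBy s t F (t e) y := by
    intro y
    rw [linkedBy_insert, hx.congr_left, hx.congr_left, hx.congr_left]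
    simp [h, LinkedBy.refl]
  have h1 : {f ∈ insert e F | LinkedBy s t F (s e) (s f) ∨ LinkedBy s t F (t e) (s f)} =
      insert e ({f ∈ F | LinkedBy s t F (s e) (s f)} ∪ {f ∈ F | LinkedBy s t F (t e) (s f)}) := by
    ext f
    simp only [Set.mem_ofPred_eq, Set.mem_insert_iff, Set.mem_union]
    constructor
    · rintro ⟨rfl | h, h'⟩
      exacts [.inl rfl, .inr (h'.imp (⟨h, ·⟩) (⟨h, ·⟩))]
    · rintro (rfl | h | h)
      exacts [⟨.inl rfl, .inl (.refl _)⟩, ⟨.inr h.1, .inl h.2⟩, ⟨.inr h.1, .inr h.2⟩]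
  have h2 : {y | LinkedBy s t F (s e) y ∨ LinkedBy s t F (t e) y}.ncard =
      {y | LinkedBy s t F (s e) y}.ncard + {y | LinkedBy s t F (t e) y}.ncard :=
    Set.ncard_union_eq (Set.disjoint_left.2 fun f hf hf' => h (LinkedBy.trans hf hf'.symm))
  simp only [excess, hl, h1]
  rw [Set.ncard_insert_of_notMem (by simp [he]),
    Set.ncard_union_eq (Set.disjoint_left.2 fun f hf hf' => h (hf.2.trans hf'.2.symm)), h2]
  push_cast; ring

theorem linkedBy_swap : LinkedBy t s F x y ↔ LinkedBy s t F x y := by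
  constructor <;>
  · intro h
    induction h with
    | rel x y h =>
      obtain ⟨e, he, rfl, rfl⟩ := h
      exact (LinkedBy.of_mem he).symm
    | refl x => exact .refl x
    | symm x y _ ih => exact ih.symm
    | trans x y z _ _ ih ih' => exact ih.trans ih'

/-- The orientation of the edges is only a bookkeeping device: an edge of `F` has both ends in the
same component. This gives the case of the target below from that of the source. -/
theorem excess_swap : excess t s F x = excess s t F x := by
  have h1 : {e | e ∈ F ∧ LinkedBy s t F x (t e)} = {e | e ∈ F ∧ LinkedBy s t F x (s e)} := by
    ext e
    exact and_congr_right fun he => ⟨fun h => h.trans (LinkedBy.of_mem he).symm,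
      fun h => h.trans (LinkedBy.of_mem he)⟩
  simp only [excess, linkedBy_swap, h1]

theorem excess_insert_of_not_linkedBy_right [Finite α] [Finite β] (h : ¬ LinkedBy s t F (s e) (t e))
    (hx : LinkedBy s t F x (t e)) :
    excess s t (insert e F) x = excess s t F (s e) + excess s t F (t e) := by
  have h' : ¬ LinkedBy t s F (t e) (s e) := by
    rw [linkedBy_swap, linkedBy_comm]; exact h
  have := excess_insert_of_not_linkedBy_left h' (linkedBy_swap.2 hx)
  rw [excess_swap, excess_swap (x := t e), excess_swap (x := s e)] at this
  rw [this, add_comm]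

theorem excess_insert_of_not_mem (hs : ¬ LinkedBy s t F x (s e)) (ht : ¬ LinkedBy s t F x (t e)) :
    excess s t (insert e F) x = excess s t F x := by
  have hl : ∀ y, LinkedBy s t (insert e F) x y ↔ LinkedBy s t F x y := by
    intro y
    rw [linkedBy_insert]
    simp [hs, ht]
  have h1 : {f ∈ insert e F | LinkedBy s t F x (s f)} = {f ∈ F | LinkedBy s t F x (s f)} := by
    ext f
    simp only [Set.mem_ofPred_eq, Set.mem_insert_iff]
    constructor
    · rintro ⟨rfl | h, h'⟩
      exacts [(hs h').elim, ⟨h, h'⟩]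
    · exact fun h => ⟨.inr h.1, h.2⟩
  simp only [excess, hl, h1]

variable [Finite β]

/-- Induction on the edges: a new edge either closes a cycle, joins two components, or misses the
component of `x`. For acyclic sets the first case never occurs. -/
theorem excess_nonneg_and [Finite α] (F : Set β) :
    (∀ x, 0 ≤ excess s t F x) ∧ (Acyclic s t F → ∀ x, excess s t F x = 0) := by
  induction F, Set.toFinite F using Set.Finite.induction_on with
  | empty => exact ⟨fun x => (excess_empty x).ge, fun _ x => excess_empty x⟩
  | @insert e F he _ ih =>
    obtain ⟨ih1, ih2⟩ := ih
    refine ⟨fun x => ?_, fun hac x => ?_⟩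
    · by_cases h : LinkedBy s t F (s e) (t e)
      · by_cases hx : LinkedBy s t F x (s e)
        · rw [excess_insert_of_linkedBy he h hx]
          have := ih1 x
          omega
        · rw [excess_insert_of_not_mem hx fun h' => hx (h'.trans h.symm)]
          exact ih1 x
      · by_cases hx : LinkedBy s t F x (s e)
        · rw [excess_insert_of_not_linkedBy_left h hx]
          exact add_nonneg (ih1 _) (ih1 _)
        by_cases hx' : LinkedBy s t F x (t e)
        · rw [excess_insert_of_not_linkedBy_right h hx']
          exact add_nonneg (ih1 _) (ih1 _)
        · rw [excess_insert_of_not_mem hx hx']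
          exact ih1 x
    · have h : ¬ LinkedBy s t F (s e) (t e) := by
        have := hac e (Set.mem_insert _ _)
        rwa [Set.insert_sdiff_self_of_notMem he] at this
      have ih3 := ih2 (hac.mono (Set.subset_insert _ _))
      by_cases hx : LinkedBy s t F x (s e)
      · rw [excess_insert_of_not_linkedBy_left h hx, ih3, ih3, add_zero]
      by_cases hx' : LinkedBy s t F x (t e)
      · rw [excess_insert_of_not_linkedBy_right h hx', ih3, ih3, add_zero]
      · rw [excess_insert_of_not_mem hx hx', ih3]

theorem excess_nonneg [Finite α] (F : Set β) (x : α) : 0 ≤ excess s t F x := (excess_nonneg_and F).1 x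

theorem Acyclic.excess_eq_zero [Finite α] (h : Acyclic s t F) (x : α) : excess s t F x = 0 :=
  (excess_nonneg_and F).2 h x

/-- If the other edges already joined the ends of `e`, putting `e` back would raise a nonnegative
excess to at least one. -/
theorem acyclic_of_excess_eq_zero [Finite α] (h : ∀ x, excess s t F x = 0) : Acyclic s t F := by
  intro e he hl
  have h1 := excess_insert_of_linkedBy (F := F \ {e}) (by simp) hl (.refl _)
  rw [Set.insert_sdiff_singleton, Set.insert_eq_of_mem he, h] at h1
  have := excess_nonneg (s := s) (t := t) (F \ {e}) (s e)
  omega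

/-- In a connected multigraph, an acyclic set of edges no two components of which contain more than
one marked vertex extends to an acyclic set each component of which contains exactly one. -/
theorem exists_acyclic_extension {E F₀ : Set β} {P : Set α} (hE : ∀ x y, LinkedBy s t E x y)
    (hP : P.Nonempty) (h₀ : F₀ ⊆ E) (hac : Acyclic s t F₀)
    (huniq : ∀ p ∈ P, ∀ q ∈ P, LinkedBy s t F₀ p q → p = q) :
    ∃ F, F₀ ⊆ F ∧ F ⊆ E ∧ Acyclic s t F ∧ ∀ x, ∃! p, p ∈ P ∧ LinkedBy s t F x p := by
  -- A maximal such set works: if some component had no marked vertex, connectedness of `E` would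
  -- give an edge from a component with a marked vertex to one without, and this edge could be
  -- added.
  obtain ⟨F, hF⟩ := (Set.toFinite {F | F₀ ⊆ F ∧ F ⊆ E ∧ Acyclic s t F ∧
    ∀ p ∈ P, ∀ q ∈ P, LinkedBy s t F p q → p = q}).exists_maximal ⟨F₀, subset_rfl, h₀, hac, huniq⟩
  obtain ⟨⟨h1, h2, h3, h4⟩, hmax⟩ := hF
  refine ⟨F, h1, h2, h3, ?_⟩
  have ex : ∀ x, ∃ p ∈ P, LinkedBy s t F x p := by
    obtain ⟨p₀, hp₀⟩ := hP
    let Q : α → Prop := fun x => ∃ p ∈ P, LinkedBy s t F x p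
    have hQ : ∀ x y, LinkedBy s t F x y → (Q x ↔ Q y) := fun x y h =>
      ⟨fun ⟨p, hp, h'⟩ => ⟨p, hp, h.symm.trans h'⟩, fun ⟨p, hp, h'⟩ => ⟨p, hp, h.trans h'⟩⟩
    have key : ∀ e ∈ E, (Q (s e) ↔ Q (t e)) := by
      intro e he
      by_contra hne
      have hnl : ¬ LinkedBy s t F (s e) (t e) := fun h => hne (hQ _ _ h)
      have hins : insert e F ∈ {F | F₀ ⊆ F ∧ F ⊆ E ∧ Acyclic s t F ∧
          ∀ p ∈ P, ∀ q ∈ P, LinkedBy s t F p q → p = q} := by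
        refine ⟨h1.trans (Set.subset_insert _ _), Set.insert_subset he h2, h3.insert hnl, ?_⟩
        intro p hp q hq hpq
        rw [linkedBy_insert] at hpq
        rcases hpq with h | ⟨h, h'⟩ | ⟨h, h'⟩
        · exact h4 p hp q hq h
        · exact (hne ⟨fun _ => ⟨q, hq, h'⟩, fun _ => ⟨p, hp, h.symm⟩⟩).elim
        · exact (hne ⟨fun _ => ⟨p, hp, h.symm⟩, fun _ => ⟨q, hq, h'⟩⟩).elim
      exact hnl (.of_mem (hmax hins (Set.subset_insert _ _) (Set.mem_insert _ _)))
    have all : ∀ x y, LinkedBy s t E x y → (Q x ↔ Q y) := by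
      intro x y h
      induction h with
      | rel x y h =>
        obtain ⟨e, he, rfl, rfl⟩ := h
        exact key e he
      | refl x => rfl
      | symm x y _ ih => exact ih.symm
      | trans x y z _ _ ih ih' => exact ih.trans ih'
    exact fun x => (all p₀ x (hE _ _)).1 ⟨p₀, hp₀, .refl _⟩
  intro x
  obtain ⟨p, hp, hxp⟩ := ex x
  exact ⟨p, ⟨hp, hxp⟩, fun q ⟨hq, hxq⟩ => h4 q hq p hp (hxq.symm.trans hxp)⟩

end EdgeSets


/-! ## Counting -/

section Counting

variable {D Q Q' L : Type*}

theorem ncard_image_congr {A : Set D} {q : D → Q} {q' : D → Q'}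
    (h : ∀ x ∈ A, ∀ y ∈ A, q x = q y ↔ q' x = q' y) : (q '' A).ncard = (q' '' A).ncard := by
  refine Set.ncard_congr (fun z hz => q' hz.choose) ?_ ?_ ?_
  · intro z hz
    exact ⟨_, hz.choose_spec.1, rfl⟩
  · intro z w hz hw hzw
    rw [← hz.choose_spec.2, ← hw.choose_spec.2]
    exact (h _ hz.choose_spec.1 _ hw.choose_spec.1).2 hzw
  · rintro _ ⟨x, hx, rfl⟩
    have hz : q x ∈ q '' A := ⟨x, hx, rfl⟩
    exact ⟨q x, hz, (h _ hz.choose_spec.1 _ hx).1 hz.choose_spec.2⟩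

theorem ncard_eq_two_mul_ncard_image [Finite D] {A : Set D} {q : D → Q} (ι : D → D)
    (hι : ∀ x ∈ A, ι x ∈ A) (hne : ∀ x ∈ A, ι x ≠ x)
    (hq : ∀ x ∈ A, ∀ y ∈ A, q x = q y ↔ y = x ∨ y = ι x) :
    A.ncard = 2 * (q '' A).ncard := by
  classical
  have := Fintype.ofFinite D
  have h1 : ∀ b ∈ A.toFinset.image q, (A.toFinset.filter fun x => q x = b).card = 2 := by
    intro b hb
    obtain ⟨x, hx, rfl⟩ := Finset.mem_image.1 hb
    rw [Set.mem_toFinset] at hx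
    have : (A.toFinset.filter fun y => q y = q x) = {x, ι x} := by
      ext y
      simp only [Finset.mem_filter, Set.mem_toFinset, Finset.mem_insert, Finset.mem_singleton]
      constructor
      · rintro ⟨hy, h⟩
        exact (hq x hx y hy).1 h.symm
      · rintro (rfl | rfl)
        · exact ⟨hx, rfl⟩
        · exact ⟨hι x hx, ((hq x hx _ (hι x hx)).2 (.inr rfl)).symm⟩
    rw [this, Finset.card_pair (hne x hx).symm]
  have h2 := Finset.card_eq_sum_card_image q A.toFinset
  rw [Finset.sum_congr rfl h1, Finset.sum_const, smul_eq_mul] at h2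
  rw [Set.ncard_eq_toFinset_card', h2, Set.ncard_eq_toFinset_card', Set.toFinset_image, mul_comm]

/-- Because `l` factors through `q` on `A`, different values of `l` have disjoint images under `q`.
This splits counts of cells according to the component in which they lie. -/
theorem ncard_image_fiberwise [Finite D] {A : Set D} {q : D → Q} {l : D → L}
    (h : ∀ x ∈ A, ∀ y ∈ A, q x = q y → l x = l y) (B : Finset L) :
    (q '' {x ∈ A | l x ∈ B}).ncard = ∑ b ∈ B, (q '' {x ∈ A | l x = b}).ncard := by
  classical
  induction B using Finset.induction_on with
  | empty => simp
  | insert b B hb ih =>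
    have h1 : {x ∈ A | l x ∈ insert b B} = {x ∈ A | l x = b} ∪ {x ∈ A | l x ∈ B} := by
      ext x
      simp [and_or_left]
    rw [Finset.sum_insert hb, ← ih, h1, Set.image_union, Set.ncard_union_eq]
    rw [Set.disjoint_left]
    rintro _ ⟨x, ⟨hx, rfl⟩, rfl⟩ ⟨y, ⟨hy, hy'⟩, hxy⟩
    exact hb (h y hy x hx hxy ▸ hy')

/-- The sign of a permutation in terms of the number of its orbits, which are the fibres of `q`. -/
theorem sign_eq_neg_one_pow [Fintype D] [DecidableEq D] (f : Equiv.Perm D) (q : D → Q)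
    (hq : ∀ x y, q x = q y ↔ f.SameCycle x y) :
    Equiv.Perm.sign f = (-1) ^ (Fintype.card D + (Set.range q).ncard) := by
  classical
  have h1 : Set.range q = q '' f.support ∪ q '' (f.supportᶜ : Finset D) := by
    rw [← Set.image_union, ← Set.image_univ, Finset.coe_compl, Set.union_compl_self]
  have h2 : (q '' (f.supportᶜ : Finset D)).ncard = f.supportᶜ.card := by
    rw [Set.InjOn.ncard_image, Set.ncard_coe_finset]
    intro x hx y _ hxy
    rw [hq] at hxy
    have hx : f x = x := by simpa using hx
    exact hxy.eq_of_left hx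
  have h3 : (q '' f.support).ncard = f.cycleFactorsFinset.card := by
    rw [ncard_image_congr (q' := f.cycleOf), ← Set.ncard_coe_finset]
    · congr 1
      ext g
      constructor
      · rintro ⟨x, hx, rfl⟩
        exact Finset.mem_coe.2 (Equiv.Perm.cycleOf_mem_cycleFactorsFinset_iff.2 hx)
      · intro hg
        rw [Finset.mem_coe] at hg
        obtain ⟨x, hx⟩ := (Equiv.Perm.mem_cycleFactorsFinset_iff.1 hg).1.nonempty_support
        exact ⟨x, Equiv.Perm.mem_cycleFactorsFinset_support_le hg hx,
          (Equiv.Perm.cycle_is_cycleOf hx hg).symm⟩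
    · intro x hx y hy
      rw [hq]
      refine ⟨fun h => h.cycleOf_eq, fun h => ?_⟩
      have hx' : x ∈ (f.cycleOf y).support := by
        rw [← h, Equiv.Perm.mem_support_cycleOf_iff]
        exact ⟨.refl _ _, hx⟩
      exact (Equiv.Perm.mem_support_cycleOf_iff.1 hx').1.symm
  have h4 : (Set.range q).ncard = f.cycleFactorsFinset.card + f.supportᶜ.card := by
    rw [h1, Set.ncard_union_eq, h2, h3]
    rw [Set.disjoint_left]
    rintro _ ⟨x, hx, rfl⟩ ⟨y, hy, hxy⟩
    have hy : f y = y := by simpa using hy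
    rw [hq] at hxy
    have := hxy.eq_of_left hy
    subst this
    exact Equiv.Perm.mem_support.1 hx hy
  have h5 : f.supportᶜ.card + f.support.card = Fintype.card D := by
    rw [Finset.card_compl_add_card]
  rw [Equiv.Perm.sign_of_cycleType, Equiv.Perm.sum_cycleType, h4, Equiv.Perm.cycleType_def,
    Multiset.card_map, ← h5, Finset.card_val]
  -- Each fixed point counts once as an element and once as an orbit, so fixed points do not affect
  -- the parity.
  rw [show f.supportᶜ.card + f.support.card + (f.cycleFactorsFinset.card + f.supportᶜ.card) =
    f.support.card + f.cycleFactorsFinset.card + 2 * f.supportᶜ.card by ring, pow_add,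
    pow_add _ _ (2 * _), pow_mul]
  simp [pow_add]

end Counting


/-! ### Orbits of a permutation as classes of a quotient -/

/-- Vertices, sides and boundary cycles are all quotients of this form, so that they can be counted
as orbits. -/
theorem quot_mk_eq_iff_sameCycle {D : Type*} (f : Equiv.Perm D) (x y : D) :
    Quot.mk (fun d e : D => e = f d) x = Quot.mk _ y ↔ f.SameCycle x y := by
  constructor
  · intro h
    replace h := Quot.eqvGen_exact h
    induction h with
    | rel x y h => exact ⟨1, h.symm⟩
    | refl x => exact .refl _ _
    | symm x y _ ih => exact ih.symm
    | trans x y z _ _ ih ih' => exact ih.trans ih'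
  · have step : ∀ x, Quot.mk (fun d e : D => e = f d) (f x) = Quot.mk _ x :=
      fun x => (Quot.sound (r := fun d e : D => e = f d) rfl).symm
    have nat : ∀ (k : ℕ) x, Quot.mk (fun d e : D => e = f d) ((f ^ k) x) = Quot.mk _ x := by
      intro k
      induction k with
      | zero => exact fun _ => rfl
      | succ k ih => intro x; rw [pow_succ', Equiv.Perm.mul_apply, step, ih]
    rintro ⟨k, rfl⟩
    obtain ⟨k, rfl | rfl⟩ := k.eq_nat_or_neg
    · rw [zpow_natCast, nat]
    · rw [← nat k ((f ^ (-(k : ℤ))) x), ← zpow_natCast f k, ← Equiv.Perm.mul_apply, ← zpow_add]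
      simp

namespace CurvedSurface

/-! ## Darts, vertices, sides and curves -/

variable (S : CurvedSurface)

instance : Finite S.Vertex := inferInstanceAs (Finite (Quot _))
instance : Finite S.Edge := inferInstanceAs (Finite (Quot _))
instance : Finite S.Curve := inferInstanceAs (Finite (Quot _))
instance : Finite S.Side := inferInstanceAs (Finite (Quot _))
instance : Finite S.BoundaryCycle := inferInstanceAs (Finite (Quot _))
instance (C : Set S.Curve) : Finite (S.Piece C) := inferInstanceAs (Finite (Quot _))
instance (C : Set S.Curve) : Nonempty (S.Piece C) := S.nonempty_region.map (S.piece C)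

variable {S}

theorem rot_four (d : S.Dart) : S.rot (S.rot (S.rot (S.rot d))) = d := by
  rcases S.valence d with ⟨_, h, _⟩ | ⟨_, h, _⟩
  · rw [h, h]
  · exact h

theorem opp_cases (d : S.Dart) :
    (S.opp d = S.rot d ∧ S.rot (S.rot d) = d ∧ S.colour (S.rot d) = S.colour d ∧ S.rot d ≠ d) ∨
    (S.opp d = S.rot (S.rot d) ∧ S.rot (S.rot d) ≠ d ∧ S.colour (S.rot d) ≠ S.colour d ∧
      S.colour (S.rot (S.rot d)) = S.colour d ∧
      S.colour (S.rot (S.rot (S.rot d))) = S.colour (S.rot d)) := by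
  unfold opp
  rcases S.valence d with ⟨h1, h2, h3⟩ | ⟨h1, h2, h3, h4⟩
  · left
    rw [if_pos h3]
    exact ⟨rfl, h2, h3, h1⟩
  · right
    rw [if_neg h3]
    refine ⟨rfl, h1, h3, h4, ?_⟩
    rcases S.valence (S.rot d) with ⟨_, _, g3⟩ | ⟨_, _, _, g4⟩
    · exact absurd (g3.symm.trans h4) h3
    · exact g4

theorem opp_ne (d : S.Dart) : S.opp d ≠ d := by
  rcases S.opp_cases d with ⟨h, _, _, h'⟩ | ⟨h, h', _⟩ <;> rwa [h]

theorem colour_opp (d : S.Dart) : S.colour (S.opp d) = S.colour d := by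
  rcases S.opp_cases d with ⟨h, _, h', _⟩ | ⟨h, _, _, h', _⟩ <;> rwa [h]

theorem opp_opp (d : S.Dart) : S.opp (S.opp d) = d := by
  rcases S.opp_cases d with ⟨h, h2, h3, _⟩ | ⟨h, h2, h3, h4, h5⟩
  · rw [h]
    rcases S.opp_cases (S.rot d) with ⟨g, _⟩ | ⟨g, _, g', _⟩
    · rw [g, h2]
    · rw [h2] at g'
      exact absurd h3.symm g'
  · rw [h]
    rcases S.opp_cases (S.rot (S.rot d)) with ⟨g, _, g', _⟩ | ⟨g, _⟩
    · exact absurd (h5.symm.trans (g'.trans h4)) h3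
    · rw [g, rot_four]

theorem vertex_rot (d : S.Dart) : S.vertex (S.rot d) = S.vertex d :=
  (Quot.sound (r := fun d e : S.Dart => e = S.rot d) rfl).symm

theorem vertex_opp (d : S.Dart) : S.vertex (S.opp d) = S.vertex d := by
  rcases S.opp_cases d with ⟨h, _⟩ | ⟨h, _⟩ <;> simp [h, vertex_rot]

theorem edge_rev (d : S.Dart) : S.edge (S.rev d) = S.edge d :=
  (Quot.sound (r := fun d e : S.Dart => e = S.rev d) rfl).symm

theorem curve_opp (d : S.Dart) : S.curve (S.opp d) = S.curve d := (Quot.sound (.inr rfl)).symm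

theorem side_opp_rev (d : S.Dart) : S.side (S.opp (S.rev d)) = S.side d :=
  (Quot.sound (r := fun d e : S.Dart => e = S.opp (S.rev d)) rfl).symm

theorem side_opp (d : S.Dart) : S.side (S.opp d) = S.side (S.rev d) := by
  rw [← side_opp_rev (S.rev d), S.rev_rev]

theorem vertex_eq_iff {d e : S.Dart} : S.vertex d = S.vertex e ↔
    e = d ∨ e = S.rot d ∨ e = S.rot (S.rot d) ∨ e = S.rot (S.rot (S.rot d)) := by
  constructor
  · intro h
    obtain ⟨k, rfl⟩ := (quot_mk_eq_iff_sameCycle S.rot d e).1 h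
    have h4 : S.rot ^ (4 : ℤ) = 1 := Equiv.ext fun d => rot_four d
    rw [← Int.mul_ediv_add_emod k 4, zpow_add, zpow_mul, h4, one_zpow, one_mul]
    have h0 := Int.emod_nonneg k (b := 4) (by norm_num)
    have h1 := Int.emod_lt_of_pos k (b := 4) (by norm_num)
    generalize k % 4 = m at h0 h1
    interval_cases m
    · exact .inl rfl
    · exact .inr (.inl rfl)
    · exact .inr (.inr (.inl rfl))
    · exact .inr (.inr (.inr rfl))
  · rintro (rfl | rfl | rfl | rfl) <;> simp only [vertex_rot]

/-- Colours alternate at a 4-valent vertex, so at most one curve of each colour passes through a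
vertex. -/
theorem vertex_eq_and_colour_eq_iff {d e : S.Dart} :
    S.vertex d = S.vertex e ∧ S.colour e = S.colour d ↔ e = d ∨ e = S.opp d := by
  constructor
  · rw [vertex_eq_iff]
    rcases S.opp_cases d with ⟨h, h2, _, _⟩ | ⟨h, h2, h3, h4, h5⟩
    · rw [h, h2]
      tauto
    · rw [h]
      rintro ⟨rfl | rfl | rfl | rfl, hc⟩
      · exact .inl rfl
      · exact absurd hc h3
      · exact .inr rfl
      · exact absurd (h5.symm.trans hc) h3
  · rintro (rfl | rfl)
    · exact ⟨rfl, rfl⟩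
    · exact ⟨(vertex_opp d).symm, colour_opp d⟩

theorem edge_eq_iff {d e : S.Dart} : S.edge d = S.edge e ↔ e = d ∨ e = S.rev d := by
  constructor
  · intro h
    replace h := Quot.eqvGen_exact h
    induction h with
    | rel x y h => exact .inr h
    | refl x => exact .inl rfl
    | symm x y _ ih =>
      rcases ih with rfl | rfl
      · exact .inl rfl
      · exact .inr (S.rev_rev _).symm
    | trans x y z _ _ ih ih' =>
      rcases ih with rfl | rfl <;> rcases ih' with rfl | rfl
      · exact .inl rfl
      · exact .inr rfl
      · exact .inr rfl
      · exact .inl (S.rev_rev _)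
  · rintro (rfl | rfl)
    · rfl
    · exact (edge_rev d).symm

theorem colour_eq_of_curve_eq {d e : S.Dart} (h : S.curve d = S.curve e) :
    S.colour d = S.colour e := by
  replace h := Quot.eqvGen_exact h
  induction h with
  | rel x y h =>
    rcases h with rfl | rfl
    · exact (S.colour_rev x).symm
    · exact (colour_opp x).symm
  | refl x => rfl
  | symm x y _ ih => exact ih.symm
  | trans x y z _ _ ih ih' => exact ih.trans ih'

/-- The permutation that follows a dart to its end and goes straight on. -/
def straight (S : CurvedSurface) : Equiv.Perm S.Dart where
  toFun d := S.opp (S.rev d)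
  invFun d := S.rev (S.opp d)
  left_inv d := by beta_reduce; rw [opp_opp, S.rev_rev]
  right_inv d := by beta_reduce; rw [S.rev_rev, opp_opp]

theorem straight_apply (d : S.Dart) : S.straight d = S.opp (S.rev d) := rfl

theorem straight_inv_apply (d : S.Dart) : S.straight⁻¹ d = S.rev (S.opp d) := rfl

theorem side_eq_iff {d e : S.Dart} : S.side d = S.side e ↔ S.straight.SameCycle d e :=
  quot_mk_eq_iff_sameCycle S.straight d e

/-- Reversal conjugates `straight` to its inverse: the other side of a curve is travelled in the
opposite direction. -/
theorem rev_straight_zpow (k : ℤ) (d : S.Dart) :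
    S.rev ((S.straight ^ k) d) = (S.straight ^ (-k)) (S.rev d) := by
  have h : S.rev * S.straight * S.rev⁻¹ = S.straight⁻¹ := by
    have h' : S.rev⁻¹ = S.rev := by
      rw [inv_eq_iff_mul_eq_one]
      exact Equiv.ext S.rev_rev
    rw [h']
    ext d
    simp [straight_apply, straight_inv_apply, S.rev_rev]
  have h2 := congrArg (· ^ k) h
  simp only [conj_zpow] at h2
  rw [zpow_neg, ← inv_zpow, ← h2]
  simp

/-- Were `rev d` on the orbit of `d`, reversal would act on this orbit as a reflection. A reflection
of a cycle fixes a dart or swaps two consecutive ones. The first contradicts `rev_ne`; the second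
would produce a dart fixed by `opp`. -/
theorem side_rev_ne (d : S.Dart) : S.side (S.rev d) ≠ S.side d := by
  intro h
  obtain ⟨k, hk⟩ := side_eq_iff.1 h.symm
  obtain ⟨m, rfl | rfl⟩ := k.even_or_odd'
  · apply S.rev_ne ((S.straight ^ m) d)
    rw [rev_straight_zpow, ← hk, ← Equiv.Perm.mul_apply, ← zpow_add]
    congr 2
    ring
  · apply S.opp_ne (S.rev ((S.straight ^ m) d))
    rw [← straight_apply, rev_straight_zpow m, ← hk, ← Equiv.Perm.mul_apply, ← zpow_one_add,
      ← Equiv.Perm.mul_apply, ← zpow_add]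
    congr 2
    ring

theorem side_rev_eq {d e : S.Dart} (h : S.side d = S.side e) :
    S.side (S.rev d) = S.side (S.rev e) := by
  obtain ⟨k, rfl⟩ := side_eq_iff.1 h
  rw [rev_straight_zpow, side_eq_iff]
  exact ⟨-k, rfl⟩

/-- The other side of a curve. -/
def Side.flip : S.Side → S.Side :=
  Quot.lift (fun d => S.side (S.rev d)) fun _ _ h => side_rev_eq (Quot.sound h)

/-- The curve with a given side. -/
def Side.curve : S.Side → S.Curve :=
  Quot.lift S.curve fun d e h => by rw [h, curve_opp, S.curve_rev]

theorem curve_side (d : S.Dart) : (S.side d).curve = S.curve d := rfl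

theorem curve_eq_of_side_eq {d e : S.Dart} (h : S.side d = S.side e) : S.curve d = S.curve e := by
  rw [← curve_side, h, curve_side]

theorem curve_eq_iff {d e : S.Dart} :
    S.curve d = S.curve e ↔ S.side e = S.side d ∨ S.side e = S.side (S.rev d) := by
  constructor
  · intro h
    replace h := Quot.eqvGen_exact h
    induction h with
    | rel x y h =>
      right
      rcases h with rfl | rfl
      · rfl
      · exact side_opp x
    | refl x => exact .inl rfl
    | symm x y _ ih =>
      refine ih.imp Eq.symm fun h => ?_
      have := side_rev_eq h
      rw [S.rev_rev] at this
      exact this.symm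
    | trans x y z _ _ ih ih' =>
      rcases ih with h | h <;> rcases ih' with h' | h'
      · exact .inl (h'.trans h)
      · exact .inr (h'.trans (side_rev_eq h))
      · exact .inr (h'.trans h)
      · have := side_rev_eq h
        rw [S.rev_rev] at this
        exact .inl (h'.trans this)
  · rintro (h | h)
    · exact (curve_eq_of_side_eq h).symm
    · rw [curve_eq_of_side_eq h, S.curve_rev]

theorem ncard_side_image {A : Set S.Dart} (hA : ∀ d ∈ A, S.rev d ∈ A) :
    (S.side '' A).ncard = 2 * (S.curve '' A).ncard := by
  have h : S.curve '' A = Side.curve '' (S.side '' A) := by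
    rw [← Set.image_comp]
    rfl
  rw [h]
  apply ncard_eq_two_mul_ncard_image Side.flip
  · rintro _ ⟨d, hd, rfl⟩
    exact ⟨_, hA d hd, rfl⟩
  · rintro _ ⟨d, _, rfl⟩
    exact side_rev_ne d
  · rintro _ ⟨d, _, rfl⟩ _ ⟨e, _, rfl⟩
    exact curve_eq_iff

theorem ncard_edge_image {A : Set S.Dart} (hA : ∀ d ∈ A, S.rev d ∈ A) :
    A.ncard = 2 * (S.edge '' A).ncard :=
  ncard_eq_two_mul_ncard_image S.rev hA (fun d _ => S.rev_ne d) fun _ _ _ _ => edge_eq_iff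

/-- The restriction to one colour makes the darts of `A` at a vertex a single pair exchanged by
`opp`. -/
theorem ncard_vertex_image {i : Bool} {A : Set S.Dart} (hA : ∀ d ∈ A, S.opp d ∈ A)
    (hi : ∀ d ∈ A, S.colour d = i) : A.ncard = 2 * (S.vertex '' A).ncard := by
  apply ncard_eq_two_mul_ncard_image S.opp hA fun d _ => S.opp_ne d
  intro d hd e he
  rw [← vertex_eq_and_colour_eq_iff, hi d hd, hi e he]
  simp

end CurvedSurface

namespace CurvedSurface

variable {S : CurvedSurface}

/-! ## The parity of the Euler characteristic -/

theorem left_eq_of_boundaryCycle_eq {d e : S.Dart} (h : S.boundaryCycle d = S.boundaryCycle e) :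
    S.left d = S.left e := by
  have key : ∀ d e : S.Dart, e = S.rev (S.rot d) → S.left d = S.left e := by
    rintro d _ rfl
    exact (S.left_rot d).symm
  exact congrArg (Quot.lift S.left key) h

/-- A boundary cycle belongs to one region, so the boundary counts add up to the number of boundary
cycles in `X`. What remains is visibly even except for four orbit counts. -/
theorem cappedEuler_eq (C : Set S.Curve) (X : S.Piece C) :
    S.cappedEuler C X = 2 * (∑ᶠ R ∈ {R : S.Region | S.piece C R = X}, (1 - (S.genus R : ℤ)))
      - ((S.boundaryCycle '' {d | S.piece C (S.left d) = X}).ncard : ℤ)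
      - ((S.edge '' {d | S.curve d ∉ C ∧ S.piece C (S.left d) = X}).ncard : ℤ)
      + ((S.vertex '' {d | (∀ e, S.vertex e = S.vertex d → S.curve e ∉ C) ∧
        S.piece C (S.left d) = X}).ncard : ℤ)
      + ((S.side '' {d | S.curve d ∈ C ∧ S.piece C (S.left d) = X}).ncard : ℤ) := by
  classical
  have hfin := Set.toFinite {R : S.Region | S.piece C R = X}
  have h := ncard_image_fiberwise (A := Set.univ) (q := S.boundaryCycle) (l := S.left)
    (fun _ _ _ _ h => left_eq_of_boundaryCycle_eq h) hfin.toFinset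
  simp only [Set.mem_univ, true_and, Set.Finite.mem_toFinset, Set.mem_ofPred_eq] at h
  unfold cappedEuler boundaryCount
  rw [finsum_mem_eq_finite_toFinset_sum _ hfin, finsum_mem_eq_finite_toFinset_sum _ hfin, h,
    Finset.mul_sum, Nat.cast_sum, ← Finset.sum_sub_distrib]
  congr 3
  exact Finset.sum_congr rfl fun _ _ => by ring_nf

theorem rot_inv_rot (d : S.Dart) : S.rot⁻¹ (S.rot d) = d := S.rot.symm_apply_apply d

/-- Two quarter turns give the opposite dart at a 4-valent vertex and the same dart at a 2-valent
one. -/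
theorem curve_rot_rot (d : S.Dart) : S.curve (S.rot (S.rot d)) = S.curve d := by
  rcases S.opp_cases d with ⟨_, h, _⟩ | ⟨h, _⟩
  · rw [h]
  · rw [← h, curve_opp]

theorem forall_vertex_eq_iff (C : Set S.Curve) (d : S.Dart) :
    (∀ e, S.vertex e = S.vertex d → S.curve e ∉ C) ↔ S.curve d ∉ C ∧ S.curve (S.rot d) ∉ C := by
  constructor
  · exact fun h => ⟨h d rfl, h _ (vertex_rot d)⟩
  · rintro ⟨h1, h2⟩ e he
    rcases vertex_eq_iff.1 he.symm with rfl | rfl | rfl | rfl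
    · exact h1
    · exact h2
    · rwa [curve_rot_rot]
    · rwa [curve_rot_rot]

/-! ### The permutations that cross edges and turn around vertices without crossing the system -/

open Classical in
/-- Cross an edge, unless it lies on `C`. -/
noncomputable def cross (C : Set S.Curve) : Equiv.Perm S.Dart :=
  Function.Involutive.toPerm (fun d => if S.curve d ∈ C then d else S.rev d) (by
    intro d
    by_cases h : S.curve d ∈ C
    · simp [h]
    · simp [h, S.curve_rev, S.rev_rev])

theorem cross_of_mem {C : Set S.Curve} {d : S.Dart} (h : S.curve d ∈ C) : cross C d = d :=
  if_pos h

theorem cross_of_not_mem {C : Set S.Curve} {d : S.Dart} (h : S.curve d ∉ C) :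
    cross C d = S.rev d := if_neg h

/-- Turn around a vertex, but without crossing `C`. -/
noncomputable def turn (C : Set S.Curve) : Equiv.Perm S.Dart := cross C * (S.rev * S.rot)

theorem turn_of_mem {C : Set S.Curve} {d : S.Dart} (h : S.curve (S.rot d) ∈ C) :
    turn C d = S.rev (S.rot d) := cross_of_mem (by rwa [← S.curve_rev] at h)

theorem turn_of_not_mem {C : Set S.Curve} {d : S.Dart} (h : S.curve (S.rot d) ∉ C) :
    turn C d = S.rot d :=
  (cross_of_not_mem (by rwa [← S.curve_rev] at h)).trans (S.rev_rev _)

open Classical in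
/-- The invariant that separates the orbits of `turn C`. -/
noncomputable def turnOrbit (C : Set S.Curve) (d : S.Dart) : S.Vertex ⊕ S.Side :=
  if S.curve d ∈ C then .inr (S.side d)
  else if S.curve (S.rot d) ∈ C then .inr (S.side (S.rot⁻¹ d)) else .inl (S.vertex d)

theorem piece_left_rev {C : Set S.Curve} {d : S.Dart} (h : S.curve d ∉ C) :
    S.piece C (S.left (S.rev d)) = S.piece C (S.left d) :=
  (Quot.sound (r := fun R R' : S.Region => ∃ d, S.curve d ∉ C ∧ S.left d = R ∧
    S.left (S.rev d) = R') ⟨d, h, rfl, rfl⟩).symm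

end CurvedSurface

namespace CurveSystem

open CurvedSurface

variable {S : CurvedSurface} {i : Bool} (C : CurveSystem S i)

variable {C} in
-- Consecutive darts of one colour occur only at 2-valent vertices.
theorem opp_eq_rot {d : S.Dart} (h : S.curve d ∈ C.curves) (h' : S.curve (S.rot d) ∈ C.curves) :
    S.opp d = S.rot d := by
  rcases S.opp_cases d with ⟨h1, _⟩ | ⟨_, _, h1, _⟩
  · exact h1
  · exact absurd ((C.colour_eq _ h').trans (C.colour_eq _ h).symm) h1

theorem opp_eq_rot_rot {C : Set S.Curve} {d : S.Dart} (h : S.curve d ∈ C)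
    (h' : S.curve (S.rot d) ∉ C) : S.opp d = S.rot (S.rot d) := by
  rcases S.opp_cases d with ⟨h1, _⟩ | ⟨h1, _⟩
  · rw [← h1, curve_opp] at h'
    exact absurd h h'
  · exact h1

theorem side_rev_opp (d : S.Dart) : S.side (S.rev (S.opp d)) = S.side d := by
  rw [side_rev_eq (side_opp d), S.rev_rev]

/-- Away from `C`, turning goes around a vertex. When the next dart lies on `C`, the turn slides
back along the curve instead, on the same side; a dart that leaves `C` transversally is labelled by
the side of the dart of `C` just before it. -/
theorem turnOrbit_turn (d : S.Dart) :
    turnOrbit C.curves (turn C.curves d) = turnOrbit C.curves d := by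
  by_cases h : S.curve (S.rot d) ∈ C.curves
  · rw [turn_of_mem h]
    have h1 : S.curve (S.rev (S.rot d)) ∈ C.curves := by rwa [S.curve_rev]
    by_cases h2 : S.curve d ∈ C.curves
    · rw [turnOrbit, if_pos h1, turnOrbit, if_pos h2, ← opp_eq_rot h2 h, side_rev_opp]
    · rw [turnOrbit, if_pos h1, turnOrbit, if_neg h2, if_pos h]
      obtain ⟨c, rfl⟩ := S.rot.surjective d
      rw [curve_rot_rot] at h
      rw [rot_inv_rot, ← opp_eq_rot_rot h h2, side_rev_opp]
  · rw [turn_of_not_mem h, turnOrbit, if_neg h, curve_rot_rot, turnOrbit, if_neg h]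
    by_cases h2 : S.curve d ∈ C.curves
    · rw [if_pos h2, if_pos h2, rot_inv_rot]
    · rw [if_neg h2, if_neg h2, vertex_rot]

/-- One step back along the side of `d` takes one turn if nothing leaves the vertex on that side,
and two turns past a transverse dart otherwise. -/
theorem sameCycle_turn_straight_inv {d : S.Dart} (h : S.curve d ∈ C.curves) :
    (turn C.curves).SameCycle d (S.rev (S.opp d)) := by
  by_cases h' : S.curve (S.rot d) ∈ C.curves
  · rw [opp_eq_rot h h', ← turn_of_mem h']
    exact ⟨1, rfl⟩
  · rw [opp_eq_rot_rot h h', ← turn_of_mem (by rwa [curve_rot_rot]), ← turn_of_not_mem h']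
    exact ⟨2, rfl⟩

theorem sameCycle_turn_of_side_eq {d e : S.Dart} (hd : S.curve d ∈ C.curves)
    (h : S.side d = S.side e) : (turn C.curves).SameCycle d e := by
  replace h := Quot.eqvGen_exact h
  induction h with
  | rel x y h =>
    have hy : S.curve y ∈ C.curves := by rwa [h, curve_opp, S.curve_rev]
    have := C.sameCycle_turn_straight_inv hy
    rw [h, opp_opp, S.rev_rev, ← h] at this
    exact this.symm
  | refl x => exact .refl _ _
  | symm x y h ih =>
    refine (ih ?_).symm
    rwa [curve_eq_of_side_eq (S := S) (Quot.eqvGen_sound h)]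
  | trans x y z h _ ih ih' =>
    refine (ih hd).trans (ih' ?_)
    rwa [← curve_eq_of_side_eq (S := S) (Quot.eqvGen_sound h)]

/-- Every orbit that meets a vertex on `C` contains a dart of `C` itself, so orbits of this kind can
be compared through sides. -/
theorem exists_sameCycle_turn {d : S.Dart}
    (h : S.curve d ∈ C.curves ∨ S.curve (S.rot d) ∈ C.curves) :
    ∃ e, S.curve e ∈ C.curves ∧ (turn C.curves).SameCycle e d ∧
      turnOrbit C.curves d = .inr (S.side e) ∧
      S.piece C.curves (S.left e) = S.piece C.curves (S.left d) := by
  by_cases hd : S.curve d ∈ C.curves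
  · exact ⟨d, hd, .refl _ _, if_pos hd, rfl⟩
  · have h := h.resolve_left hd
    obtain ⟨c, rfl⟩ := S.rot.surjective d
    refine ⟨c, by rwa [curve_rot_rot] at h, ?_, ?_, ?_⟩
    · rw [← turn_of_not_mem hd]
      exact ⟨1, rfl⟩
    · rw [turnOrbit, if_neg hd, if_pos h, rot_inv_rot]
    · rw [← S.left_rot c, piece_left_rev hd]

theorem turnOrbit_eq_iff (d e : S.Dart) : turnOrbit C.curves d = turnOrbit C.curves e ↔
    (turn C.curves).SameCycle d e := by
  constructor
  · intro h
    have inl : ∀ {x}, ¬ (S.curve x ∈ C.curves ∨ S.curve (S.rot x) ∈ C.curves) →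
        turnOrbit C.curves x = .inl (S.vertex x) := by
      intro x hx
      rw [not_or] at hx
      rw [turnOrbit, if_neg hx.1, if_neg hx.2]
    by_cases hd : S.curve d ∈ C.curves ∨ S.curve (S.rot d) ∈ C.curves
    · obtain ⟨d', h1, h2, h3, _⟩ := C.exists_sameCycle_turn hd
      by_cases he : S.curve e ∈ C.curves ∨ S.curve (S.rot e) ∈ C.curves
      · obtain ⟨e', _, g2, g3, _⟩ := C.exists_sameCycle_turn he
        rw [h3, g3] at h
        exact h2.symm.trans ((C.sameCycle_turn_of_side_eq h1 (Sum.inr_injective h)).trans g2)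
      · rw [h3, inl he] at h
        cases h
    · by_cases he : S.curve e ∈ C.curves ∨ S.curve (S.rot e) ∈ C.curves
      · obtain ⟨e', _, _, g3, _⟩ := C.exists_sameCycle_turn he
        rw [g3, inl hd] at h
        cases h
      · rw [inl hd, inl he] at h
        rw [not_or] at hd
        have step : ∀ x, S.curve (S.rot x) ∉ C.curves →
            (turn C.curves).SameCycle x (S.rot x) := by
          intro x hx
          rw [← turn_of_not_mem hx]
          exact ⟨1, rfl⟩
        have s1 := step d hd.2
        have s2 := step (S.rot d) (by rw [curve_rot_rot]; exact hd.1)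
        have s3 := step (S.rot (S.rot d)) (by rw [curve_rot_rot]; exact hd.2)
        rcases vertex_eq_iff.1 (Sum.inl_injective h) with rfl | rfl | rfl | rfl
        · exact .refl _ _
        · exact s1
        · exact s1.trans s2
        · exact s1.trans (s2.trans s3)
  · intro h
    have key : ∀ d e : S.Dart, e = turn C.curves d →
        turnOrbit C.curves d = turnOrbit C.curves e := by
      rintro d _ rfl
      exact (C.turnOrbit_turn d).symm
    exact congrArg (Quot.lift (turnOrbit C.curves) key) ((quot_mk_eq_iff_sameCycle _ d e).2 h)

/-- The orbits of `turn` inside `X` are the vertices of the capped surface's cell structure: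
interior vertices, and one collapsed boundary circle for each side of `C` facing `X`. -/
theorem ncard_turnOrbit_image (X : C.Piece) :
    (turnOrbit C.curves '' {d | S.piece C.curves (S.left d) = X}).ncard =
      (S.vertex '' {d | (∀ e, S.vertex e = S.vertex d → S.curve e ∉ C.curves) ∧
        S.piece C.curves (S.left d) = X}).ncard +
      (S.side '' {d | S.curve d ∈ C.curves ∧ S.piece C.curves (S.left d) = X}).ncard := by
  have h : turnOrbit C.curves '' {d | S.piece C.curves (S.left d) = X} =
      Sum.inl '' (S.vertex '' {d | (∀ e, S.vertex e = S.vertex d → S.curve e ∉ C.curves) ∧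
        S.piece C.curves (S.left d) = X}) ∪
      Sum.inr '' (S.side '' {d | S.curve d ∈ C.curves ∧ S.piece C.curves (S.left d) = X}) := by
    ext q
    constructor
    · rintro ⟨d, hd, rfl⟩
      by_cases h : S.curve d ∈ C.curves ∨ S.curve (S.rot d) ∈ C.curves
      · obtain ⟨e, h1, _, h3, h4⟩ := C.exists_sameCycle_turn h
        rw [h3]
        exact .inr ⟨_, ⟨e, ⟨h1, h4.trans hd⟩, rfl⟩, rfl⟩
      · rw [not_or] at h
        rw [turnOrbit, if_neg h.1, if_neg h.2]
        exact .inl ⟨_, ⟨d, ⟨(forall_vertex_eq_iff _ _).2 h, hd⟩, rfl⟩, rfl⟩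
    · rintro (⟨_, ⟨d, ⟨h1, h2⟩, rfl⟩, rfl⟩ | ⟨_, ⟨d, ⟨h1, h2⟩, rfl⟩, rfl⟩)
      · rw [forall_vertex_eq_iff] at h1
        exact ⟨d, h2, by rw [turnOrbit, if_neg h1.1, if_neg h1.2]⟩
      · exact ⟨d, h2, by rw [turnOrbit, if_pos h1]⟩
  rw [h, Set.ncard_union_eq, Set.ncard_image_of_injective _ Sum.inl_injective,
    Set.ncard_image_of_injective _ Sum.inr_injective]
  rw [Set.disjoint_left]
  rintro _ ⟨_, _, rfl⟩ ⟨_, _, h⟩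
  cases h

/-- On the darts with left region in `X`, `turn` is the product of `cross` and `rev * rot`. The sign
of a permutation is given by the parity of the number of elements plus the number of orbits.
Multiplicativity of signs therefore relates the numbers of vertices, sides, edges and boundary
cycles modulo two. -/
theorem even_cappedEuler (X : C.Piece) : Even (S.cappedEuler C.curves X) := by
  classical
  have := Fintype.ofFinite S.Dart
  let A : Set S.Dart := {d | S.piece C.curves (S.left d) = X}
  let p : S.Dart → Prop := fun d => S.piece C.curves (S.left d) = X
  have hβ : ∀ d, p ((S.rev * S.rot) d) ↔ p d := fun d => by
    change S.piece _ (S.left (S.rev (S.rot d))) = X ↔ _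
    rw [S.left_rot]
  have hε : ∀ d, p (cross C.curves d) ↔ p d := fun d => by
    change S.piece _ _ = X ↔ S.piece _ _ = X
    by_cases h : S.curve d ∈ C.curves
    · rw [cross_of_mem h]
    · rw [cross_of_not_mem h, piece_left_rev h]
  have hψ : ∀ d, p (turn C.curves d) ↔ p d := fun d => (hε _).trans (hβ d)
  have hmul : (turn C.curves).subtypePerm hψ =
      (cross C.curves).subtypePerm hε * (S.rev * S.rot).subtypePerm hβ := by
    ext d
    rfl
  have hrange : ∀ {Q : Type} (q : S.Dart → Q), Set.range (fun d : {d // p d} => q d) = q '' A := by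
    intro Q q
    ext z
    simp [p, A]
  have sβ := sign_eq_neg_one_pow ((S.rev * S.rot).subtypePerm hβ) (fun d => S.boundaryCycle d)
    fun d e => by
      rw [Equiv.Perm.sameCycle_subtypePerm]
      exact quot_mk_eq_iff_sameCycle (S.rev * S.rot) _ _
  have sψ := sign_eq_neg_one_pow ((turn C.curves).subtypePerm hψ)
    (fun d => turnOrbit C.curves d) fun d e => by
      rw [Equiv.Perm.sameCycle_subtypePerm, turnOrbit_eq_iff]
  -- The orbits of `cross`: a dart on `C` is fixed, the other darts are paired into edges.
  let qε : S.Dart → S.Edge ⊕ S.Dart := fun d =>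
    if S.curve d ∈ C.curves then .inr d else .inl (S.edge d)
  have hqε : ∀ d e, qε d = qε e ↔ (cross C.curves).SameCycle d e := by
    intro d e
    constructor
    · intro h
      by_cases hd : S.curve d ∈ C.curves <;> by_cases he : S.curve e ∈ C.curves <;>
        simp only [qε, hd, he, if_true, if_false] at h
      · cases h
        exact .refl _ _
      · cases h
      · cases h
      · rcases edge_eq_iff.1 (Sum.inl_injective h) with rfl | rfl
        · exact .refl _ _
        · rw [← cross_of_not_mem hd]
          exact ⟨1, rfl⟩
    · intro h
      have key : ∀ d e : S.Dart, e = cross C.curves d → qε d = qε e := by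
        rintro d _ rfl
        by_cases hd : S.curve d ∈ C.curves
        · rw [cross_of_mem hd]
        · simp only [cross_of_not_mem hd, qε, S.curve_rev, hd, if_false, edge_rev]
      exact congrArg (Quot.lift qε key) ((quot_mk_eq_iff_sameCycle _ d e).2 h)
  have sε := sign_eq_neg_one_pow ((cross C.curves).subtypePerm hε) (fun d => qε d)
    fun d e => by rw [Equiv.Perm.sameCycle_subtypePerm, hqε]
  have hA1 : A = {d | S.curve d ∉ C.curves ∧ S.piece C.curves (S.left d) = X} ∪
      {d | S.curve d ∈ C.curves ∧ S.piece C.curves (S.left d) = X} := by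
    ext d
    simp only [A, Set.mem_ofPred_eq, Set.mem_union]
    tauto
  have hεc : (qε '' A).ncard =
      (S.edge '' {d | S.curve d ∉ C.curves ∧ S.piece C.curves (S.left d) = X}).ncard +
      {d | S.curve d ∈ C.curves ∧ S.piece C.curves (S.left d) = X}.ncard := by
    have e1 : qε '' {d | S.curve d ∉ C.curves ∧ S.piece C.curves (S.left d) = X} =
        Sum.inl '' (S.edge '' {d | S.curve d ∉ C.curves ∧ S.piece C.curves (S.left d) = X}) := by
      rw [← Set.image_comp]
      exact Set.image_congr fun d hd => if_neg hd.1
    have e2 : qε '' {d | S.curve d ∈ C.curves ∧ S.piece C.curves (S.left d) = X} =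
        Sum.inr '' {d | S.curve d ∈ C.curves ∧ S.piece C.curves (S.left d) = X} :=
      Set.image_congr fun d hd => if_pos hd.1
    rw [hA1, Set.image_union, e1, e2, Set.ncard_union_eq,
      Set.ncard_image_of_injective _ Sum.inl_injective,
      Set.ncard_image_of_injective _ Sum.inr_injective]
    rw [Set.disjoint_left]
    rintro _ ⟨_, _, rfl⟩ ⟨_, _, h⟩
    cases h
  have hm : Fintype.card {d // p d} =
      2 * (S.edge '' {d | S.curve d ∉ C.curves ∧ S.piece C.curves (S.left d) = X}).ncard +
      {d | S.curve d ∈ C.curves ∧ S.piece C.curves (S.left d) = X}.ncard := by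
    rw [← ncard_edge_image
      (A := {d | S.curve d ∉ C.curves ∧ S.piece C.curves (S.left d) = X})
      (fun d hd => ⟨by rw [S.curve_rev]; exact hd.1, (piece_left_rev hd.1).trans hd.2⟩), ← Set.ncard_union_eq, ← hA1, ← Nat.card_eq_fintype_card]
    · rfl
    · rw [Set.disjoint_left]
      exact fun d h h' => h.1 h'.1
  rw [hmul, map_mul, sβ, sε, hrange, hrange, hrange, hεc, ncard_turnOrbit_image, ← pow_add, hm]
    at sψ
  rw [cappedEuler_eq]
  change _ = (-1 : ℤˣ) ^ _ at sψ
  generalize (S.vertex '' {d | (∀ e, S.vertex e = S.vertex d → S.curve e ∉ C.curves) ∧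
        S.piece C.curves (S.left d) = X}).ncard = v at *
  generalize (S.edge '' {d | S.curve d ∉ C.curves ∧ S.piece C.curves (S.left d) = X}).ncard = e
    at *
  generalize (S.side '' {d | S.curve d ∈ C.curves ∧ S.piece C.curves (S.left d) = X}).ncard = w
    at *
  generalize {d | S.curve d ∈ C.curves ∧ S.piece C.curves (S.left d) = X}.ncard = k at *
  change (-1 : ℤˣ) ^ (_ + (_ + (S.boundaryCycle ''
    {d | S.piece C.curves (S.left d) = X}).ncard)) = _ at sψ
  generalize (S.boundaryCycle '' {d | S.piece C.curves (S.left d) = X}).ncard = b at *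
  generalize (∑ᶠ R ∈ {R : S.Region | S.piece C.curves R = X}, (1 - (S.genus R : ℤ))) = g
  have hev : Even ((2 * e + k + (e + k) + (2 * e + k + b)) + (2 * e + k + (v + w))) := by
    rw [← neg_one_pow_eq_one_iff_even (R := ℤ) (by norm_num)]
    have h1 : (-1 : ℤˣ) ^ ((2 * e + k + (e + k) + (2 * e + k + b)) + (2 * e + k + (v + w))) = 1 := by
      rw [pow_add, sψ, ← pow_add, ← two_mul, pow_mul]
      simp
    have h2 := congrArg (fun u : ℤˣ => (u : ℤ)) h1
    simpa using h2
  obtain ⟨m, hm⟩ := hev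
  -- Here `7 * e + 4 * k + b + v + w = 2 * m`; solving for `v + w` in `2 * g - b - e + v + w` and
  -- halving gives the witness.
  exact ⟨g - b - 4 * e + m - 2 * k, by omega⟩

end CurveSystem
namespace CurveSystem

open CurvedSurface

variable {S : CurvedSurface} {i : Bool} (C : CurveSystem S i)

/-! ## Removing curves from a system -/

/-- The component on the left of a chosen dart of a curve. -/
noncomputable def src (γ : S.Curve) : C.Piece := S.piece C.curves (S.left (Quot.out γ))

/-- The component on the right of a chosen dart of a curve. -/
noncomputable def tgt (γ : S.Curve) : C.Piece := S.piece C.curves (S.left (S.rev (Quot.out γ)))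

theorem curve_out (γ : S.Curve) : S.curve (Quot.out γ) = γ := Quot.out_eq γ

variable {C}

/-- The dart chosen by `Quot.out` orients the edge arbitrarily, so only the unordered pair of ends
is meaningful. -/
theorem ends_of_mem {d : S.Dart} (hd : S.curve d ∈ C.curves) :
    (S.piece C.curves (S.left d) = C.src (S.curve d) ∧
      S.piece C.curves (S.left (S.rev d)) = C.tgt (S.curve d)) ∨
    (S.piece C.curves (S.left d) = C.tgt (S.curve d) ∧
      S.piece C.curves (S.left (S.rev d)) = C.src (S.curve d)) :=
  C.pieces_of_curve_eq hd (curve_out _).symm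

variable (C) (F : Set S.Curve)

/-- The component of the surface cut along fewer curves that contains a given component. -/
def merge : C.Piece → (C.remove F).Piece :=
  Quot.lift (S.piece (C.remove F).curves) (by
    rintro _ _ ⟨d, hd, rfl, rfl⟩
    exact (piece_left_rev fun h => hd h.1).symm)

theorem merge_piece (R : S.Region) :
    C.merge F (S.piece C.curves R) = S.piece (C.remove F).curves R := rfl

theorem merge_surjective : Function.Surjective (C.merge F) := by
  intro Z
  induction Z using Quot.ind with
  | mk R => exact ⟨S.piece C.curves R, rfl⟩

variable {F}

theorem merge_src_eq_merge_tgt {γ : S.Curve} (h : γ ∈ F) :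
    C.merge F (C.src γ) = C.merge F (C.tgt γ) :=
  (piece_left_rev fun h' => h'.2 ((curve_out γ).symm ▸ h)).symm

/-- Crossing an edge of a removed curve is a step along the corresponding dual edge; crossing any
other permitted edge stays in the same old component. -/
theorem merge_eq_iff (hF : F ⊆ C.curves) {X Y : C.Piece} :
    C.merge F X = C.merge F Y ↔ LinkedBy C.src C.tgt F X Y := by
  constructor
  · have key : ∀ R R' : S.Region,
        (∃ d, S.curve d ∉ (C.remove F).curves ∧ S.left d = R ∧ S.left (S.rev d) = R') →
        LinkedBy C.src C.tgt F (S.piece C.curves R) (S.piece C.curves R') := by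
      rintro _ _ ⟨d, hd, rfl, rfl⟩
      by_cases h : S.curve d ∈ F
      · rcases ends_of_mem (hF h) with ⟨h1, h2⟩ | ⟨h1, h2⟩ <;> rw [h1, h2]
        · exact .of_mem h
        · exact (LinkedBy.of_mem h).symm
      · rw [piece_left_rev fun h' => hd ⟨h', h⟩]
        exact .refl _
    induction X using Quot.ind with
    | mk R =>
    induction Y using Quot.ind with
    | mk R' =>
    intro h
    replace h := Quot.eqvGen_exact h
    induction h with
    | rel x y h => exact key x y h
    | refl x => exact .refl _
    | symm x y _ ih => exact ih.symm
    | trans x y z _ _ ih ih' => exact ih.trans ih'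
  · intro h
    induction h with
    | rel x y h =>
      obtain ⟨γ, hγ, rfl, rfl⟩ := h
      exact C.merge_src_eq_merge_tgt hγ
    | refl x => rfl
    | symm x y _ ih => exact ih.symm
    | trans x y z _ _ ih ih' => exact ih.trans ih'

/-! ### Cell counts and genus of a merged component -/

theorem finsum_region_merge (f : S.Region → ℤ) (Z : (C.remove F).Piece) (B : Finset C.Piece)
    (hB : ∀ X, X ∈ B ↔ C.merge F X = Z) :
    ∑ᶠ R ∈ {R | S.piece (C.remove F).curves R = Z}, f R =
      ∑ X ∈ B, ∑ᶠ R ∈ {R | S.piece C.curves R = X}, f R := by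
  classical
  have := Fintype.ofFinite S.Region
  simp only [finsum_mem_eq_toFinset_sum]
  rw [← Finset.sum_fiberwise_of_maps_to (t := B) (g := S.piece C.curves)]
  · refine Finset.sum_congr rfl fun X hX => Finset.sum_congr ?_ fun _ _ => rfl
    ext R
    simp only [Finset.mem_filter, Set.mem_toFinset, Set.mem_ofPred_eq, and_iff_right_iff_imp]
    rintro rfl
    exact (hB _).1 hX
  · intro R hR
    have hR' := Set.mem_toFinset.1 hR
    exact (hB _).2 hR'

variable (F) in
/-- The darts on curves of `F` whose left side lies in `Z`. -/
def facing (Z : (C.remove F).Piece) : Set S.Dart :=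
  {d | S.curve d ∈ F ∧ S.piece (C.remove F).curves (S.left d) = Z}

theorem rev_mem_facing {Z : (C.remove F).Piece} {d : S.Dart} (hd : d ∈ C.facing F Z) :
    S.rev d ∈ C.facing F Z :=
  ⟨by rw [S.curve_rev]; exact hd.1, (piece_left_rev fun h => h.2 hd.1).trans hd.2⟩

theorem opp_mem_facing (hF : F ⊆ C.curves) {Z : (C.remove F).Piece} {d : S.Dart}
    (hd : d ∈ C.facing F Z) : S.opp d ∈ C.facing F Z := by
  refine ⟨by rw [curve_opp]; exact hd.1, ?_⟩
  rw [← merge_piece, (C.piece_opp (hF hd.1)).1, merge_piece]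
  exact (C.rev_mem_facing hd).2

/-- A circle has Euler characteristic zero: the facing darts are paired by `rev` into edges and by
`opp` into vertices. -/
theorem ncard_vertex_facing (hF : F ⊆ C.curves) (Z : (C.remove F).Piece) :
    (S.vertex '' C.facing F Z).ncard = (S.edge '' C.facing F Z).ncard := by
  have h1 := ncard_edge_image (A := C.facing F Z) fun d hd => C.rev_mem_facing hd
  have h2 := ncard_vertex_image (A := C.facing F Z) (i := i)
    (fun d hd => C.opp_mem_facing hF hd) fun d hd => C.colour_eq d (hF hd.1)
  omega

theorem curve_image_facing (hF : F ⊆ C.curves) (Z : (C.remove F).Piece) :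
    S.curve '' C.facing F Z = {γ ∈ F | C.merge F (C.src γ) = Z} := by
  ext γ
  constructor
  · rintro ⟨d, ⟨h1, h2⟩, rfl⟩
    refine ⟨h1, ?_⟩
    rw [← h2, ← merge_piece]
    rcases ends_of_mem (hF h1) with ⟨h, _⟩ | ⟨h, _⟩
    · rw [h]
    · rw [h, C.merge_src_eq_merge_tgt h1]
  · rintro ⟨h1, h2⟩
    exact ⟨Quot.out γ, ⟨by rwa [curve_out], h2⟩, curve_out γ⟩

theorem ncard_edge_remove (hF : F ⊆ C.curves) (Z : (C.remove F).Piece) (B : Finset C.Piece)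
    (hB : ∀ X, X ∈ B ↔ C.merge F X = Z) :
    (S.edge '' {d | S.curve d ∉ (C.remove F).curves ∧
        S.piece (C.remove F).curves (S.left d) = Z}).ncard =
      ∑ X ∈ B, (S.edge '' {d | S.curve d ∉ C.curves ∧ S.piece C.curves (S.left d) = X}).ncard +
      (S.edge '' C.facing F Z).ncard := by
  have h := ncard_image_fiberwise (A := {d | S.curve d ∉ C.curves}) (q := S.edge)
    (l := fun d => S.piece C.curves (S.left d)) (by
      intro d hd e _ hde
      rcases edge_eq_iff.1 hde with rfl | rfl
      · rfl
      · exact (piece_left_rev hd).symm) B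
  simp only [Set.mem_ofPred_eq, hB, merge_piece] at h
  rw [← h, ← Set.ncard_union_eq, ← Set.image_union]
  · congr 2
    ext d
    simp only [facing, remove, Set.mem_ofPred_eq, Set.mem_union, Set.mem_sdiff]
    have := @hF (S.curve d)
    tauto
  · rw [Set.disjoint_left]
    rintro _ ⟨d, ⟨hd, _⟩, rfl⟩ ⟨e, ⟨he, _⟩, hde⟩
    apply hd
    rcases edge_eq_iff.1 hde with rfl | rfl
    · exact hF he
    · rw [S.curve_rev]
      exact hF he

theorem ncard_vertex_remove (hF : F ⊆ C.curves) (Z : (C.remove F).Piece) (B : Finset C.Piece)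
    (hB : ∀ X, X ∈ B ↔ C.merge F X = Z) :
    (S.vertex '' {d | (∀ e, S.vertex e = S.vertex d → S.curve e ∉ (C.remove F).curves) ∧
        S.piece (C.remove F).curves (S.left d) = Z}).ncard =
      ∑ X ∈ B, (S.vertex '' {d | (∀ e, S.vertex e = S.vertex d → S.curve e ∉ C.curves) ∧
        S.piece C.curves (S.left d) = X}).ncard +
      (S.vertex '' C.facing F Z).ncard := by
  have rot_step : ∀ d, S.curve (S.rot d) ∉ C.curves →
      S.piece C.curves (S.left (S.rot d)) = S.piece C.curves (S.left d) := fun d hd => by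
    rw [← piece_left_rev hd, S.left_rot]
  have h := ncard_image_fiberwise
    (A := {d | ∀ e, S.vertex e = S.vertex d → S.curve e ∉ C.curves}) (q := S.vertex)
    (l := fun d => S.piece C.curves (S.left d)) (by
      intro d hd e _ hde
      have h1 := rot_step d (hd _ (vertex_rot d))
      have h2 := rot_step (S.rot d) (hd _ (by simp only [vertex_rot]))
      have h3 := rot_step (S.rot (S.rot d)) (hd _ (by simp only [vertex_rot]))
      rcases vertex_eq_iff.1 hde with rfl | rfl | rfl | rfl
      · rfl
      · exact h1.symm
      · exact (h2.trans h1).symm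
      · exact (h3.trans (h2.trans h1)).symm) B
  simp only [Set.mem_ofPred_eq, hB, merge_piece] at h
  rw [← h, ← Set.ncard_union_eq]
  · congr 1
    ext v
    constructor
    · rintro ⟨d, ⟨h1, h2⟩, rfl⟩
      by_cases hd : ∀ e, S.vertex e = S.vertex d → S.curve e ∉ C.curves
      · exact .inl ⟨d, ⟨hd, h2⟩, rfl⟩
      · right
        rw [forall_vertex_eq_iff] at h1 hd
        by_cases hd' : S.curve d ∈ C.curves
        · exact ⟨d, ⟨by_contra fun h => h1.1 ⟨hd', h⟩, h2⟩, rfl⟩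
        -- Only the transverse darts lie on `C`. Then `rot d` represents the vertex, and its left
        -- region is in `Z` because its edge is no longer cut.
        · have hr : S.curve (S.rot d) ∈ C.curves := by_contra fun h => hd ⟨hd', h⟩
          refine ⟨S.rot d, ⟨by_contra fun h => h1.2 ⟨hr, h⟩, ?_⟩, vertex_rot d⟩
          rw [← piece_left_rev h1.2, S.left_rot, h2]
    · rintro (⟨d, ⟨h1, h2⟩, rfl⟩ | ⟨d, ⟨h1, h2⟩, rfl⟩)
      · exact ⟨d, ⟨fun e he h => h1 e he h.1, h2⟩, rfl⟩
      · refine ⟨d, ⟨?_, h2⟩, rfl⟩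
        rw [forall_vertex_eq_iff]
        refine ⟨fun h => h.2 h1, fun h => h.2 ?_⟩
        -- If the next dart is also on `C`, the vertex is 2-valent and that dart lies on the same
        -- removed curve.
        rwa [← opp_eq_rot (hF h1) h.1, curve_opp]
  · rw [Set.disjoint_left]
    rintro _ ⟨d, ⟨hd, _⟩, rfl⟩ ⟨e, ⟨he, _⟩, hde⟩
    exact hd e hde (hF he)

theorem ncard_side_remove (hF : F ⊆ C.curves) (Z : (C.remove F).Piece) (B : Finset C.Piece)
    (hB : ∀ X, X ∈ B ↔ C.merge F X = Z) :
    (S.side '' {d | S.curve d ∈ (C.remove F).curves ∧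
        S.piece (C.remove F).curves (S.left d) = Z}).ncard + (S.side '' C.facing F Z).ncard =
      ∑ X ∈ B, (S.side '' {d | S.curve d ∈ C.curves ∧ S.piece C.curves (S.left d) = X}).ncard := by
  have h := ncard_image_fiberwise (A := {d | S.curve d ∈ C.curves}) (q := S.side)
    (l := fun d => S.piece C.curves (S.left d)) (by
      intro d hd e _ hde
      replace hde := Quot.eqvGen_exact hde
      induction hde with
      | rel x y h =>
        have hx : S.curve (S.rev x) ∈ C.curves := by rwa [S.curve_rev]
        rw [h, (C.piece_opp hx).1, S.rev_rev]
      | refl x => rfl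
      | symm x y h ih =>
        refine (ih ?_ ?_).symm
        · rwa [Set.mem_ofPred_eq, curve_eq_of_side_eq (S := S) (Quot.eqvGen_sound h)]
        · exact hd
      | trans x y z h _ ih ih' =>
        have hy : S.curve y ∈ C.curves := by
          rwa [← curve_eq_of_side_eq (S := S) (Quot.eqvGen_sound h)]
        exact (ih hd hy).trans (ih' hy ‹_›)) B
  simp only [Set.mem_ofPred_eq, hB, merge_piece] at h
  rw [← h, ← Set.ncard_union_eq, ← Set.image_union]
  · congr 2
    ext d
    simp only [facing, remove, Set.mem_ofPred_eq, Set.mem_union, Set.mem_sdiff]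
    have := @hF (S.curve d)
    tauto
  · rw [Set.disjoint_left]
    rintro _ ⟨d, ⟨hd, _⟩, rfl⟩ ⟨e, ⟨he, _⟩, hde⟩
    rw [curve_eq_of_side_eq hde] at he
    exact hd.2 he

theorem ncard_boundaryCycle_remove (Z : (C.remove F).Piece) (B : Finset C.Piece)
    (hB : ∀ X, X ∈ B ↔ C.merge F X = Z) :
    (S.boundaryCycle '' {d | S.piece (C.remove F).curves (S.left d) = Z}).ncard =
      ∑ X ∈ B, (S.boundaryCycle '' {d | S.piece C.curves (S.left d) = X}).ncard := by
  have h := ncard_image_fiberwise (A := Set.univ) (q := S.boundaryCycle)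
    (l := fun d => S.piece C.curves (S.left d))
    (fun _ _ _ _ h => congrArg _ (left_eq_of_boundaryCycle_eq h)) B
  simp only [Set.mem_univ, true_and, hB, merge_piece] at h
  exact h

/-- The edges and vertices gained along `F` cancel, and each removed curve inside `Z` costs the two
discs that capped its sides. -/
theorem cappedEuler_remove (hF : F ⊆ C.curves) (Z : (C.remove F).Piece) (B : Finset C.Piece)
    (hB : ∀ X, X ∈ B ↔ C.merge F X = Z) :
    S.cappedEuler (C.remove F).curves Z =
      ∑ X ∈ B, S.cappedEuler C.curves X - 2 * ({γ ∈ F | C.merge F (C.src γ) = Z}.ncard : ℤ) := by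
  simp only [cappedEuler_eq, Finset.sum_add_distrib, Finset.sum_sub_distrib, ← Finset.mul_sum]
  rw [C.finsum_region_merge _ Z B hB, C.ncard_boundaryCycle_remove Z B hB,
    C.ncard_edge_remove hF Z B hB, C.ncard_vertex_remove hF Z B hB, ← C.curve_image_facing hF]
  have h1 := C.ncard_side_remove hF Z B hB
  have h2 := ncard_side_image (A := C.facing F Z) fun d hd => C.rev_mem_facing hd
  have h3 := C.ncard_vertex_facing hF Z
  simp only [← Nat.cast_sum, ← h1, h2, h3]
  push_cast
  ring

/-- Parity is what makes the integer division in `pieceGenus` exact. -/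
theorem cappedEuler_eq_two_sub (X : C.Piece) : S.cappedEuler C.curves X = 2 - 2 * C.genus X := by
  obtain ⟨m, hm⟩ := C.even_cappedEuler X
  unfold genus pieceGenus
  omega

/-- Substituting `2 - 2 * genus` for the Euler characteristics leaves the number of edges minus the
number of vertices plus one for the component of `X` under `F`, which is `excess`. -/
theorem genus_merge (hF : F ⊆ C.curves) (X : C.Piece) :
    (C.remove F).genus (C.merge F X) =
      ∑ᶠ Y ∈ {Y | LinkedBy C.src C.tgt F X Y}, C.genus Y + excess C.src C.tgt F X := by
  classical
  have hfin := Set.toFinite {Y | LinkedBy C.src C.tgt F X Y}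
  have h := C.cappedEuler_remove hF (C.merge F X) hfin.toFinset (by
    intro Y
    rw [hfin.mem_toFinset, eq_comm, C.merge_eq_iff hF]
    rfl)
  have h1 : {γ ∈ F | C.merge F (C.src γ) = C.merge F X} =
      {γ ∈ F | LinkedBy C.src C.tgt F X (C.src γ)} := by
    ext γ
    simp only [Set.mem_ofPred_eq, ← C.merge_eq_iff hF, eq_comm]
  rw [h1, cappedEuler_eq_two_sub] at h
  simp only [cappedEuler_eq_two_sub, Finset.sum_sub_distrib, ← Finset.mul_sum, Finset.sum_const,
    ← Set.ncard_eq_toFinset_card _ hfin, nsmul_eq_mul] at h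
  rw [finsum_mem_eq_finite_toFinset_sum _ hfin, excess]
  linarith

end CurveSystem

/-! ### Sums determined by the multiplicities of the nonzero values -/

theorem sum_comp_eq_sum_ncard {γ : Type*} [Fintype γ] {k : γ → ℤ} {I : Finset ℤ}
    (hk : ∀ x, k x ∈ I) (φ : ℤ → ℤ) : ∑ x, φ (k x) = ∑ g ∈ I, {x | k x = g}.ncard * φ g := by
  classical
  rw [← Finset.sum_fiberwise_of_maps_to (t := I) (g := k) fun x _ => hk x]
  refine Finset.sum_congr rfl fun g _ => ?_
  rw [Finset.sum_congr rfl fun x hx => by rw [(Finset.mem_filter.1 hx).2], Finset.sum_const,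
    nsmul_eq_mul, Set.ncard_eq_toFinset_card']
  simp

/-- `SameCompressionBody` is blind to spheres, so it controls sums of functions of the genus that
vanish at zero. It is used for the total genus and for the number of components of positive genus.
-/
theorem sum_comp_eq_sum_comp {α β : Type*} [Fintype α] [Fintype β] {f : α → ℤ} {f' : β → ℤ}
    (h : ∀ g : ℤ, g ≠ 0 → {x | f x = g}.ncard = {y | f' y = g}.ncard) (φ : ℤ → ℤ) (hφ : φ 0 = 0) :
    ∑ x, φ (f x) = ∑ y, φ (f' y) := by
  classical
  let I := Finset.univ.image f ∪ Finset.univ.image f'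
  rw [sum_comp_eq_sum_ncard (k := f) (I := I) (fun x => by simp [I]),
    sum_comp_eq_sum_ncard (k := f') (I := I) (fun x => by simp [I])]
  refine Finset.sum_congr rfl fun g _ => ?_
  by_cases hg : g = 0
  · simp [hg, hφ]
  · rw [h g hg]

namespace CurveSystem

open CurvedSurface

variable {S : CurvedSurface} {i : Bool} (C : CurveSystem S i)

/-! ## The graphs along which a system is reduced, in terms of their edges -/

theorem dualGraph_isLink_iff {γ : S.Curve} {X Y : C.Piece} : C.dualGraph.IsLink γ X Y ↔
    γ ∈ C.curves ∧ ((X = C.src γ ∧ Y = C.tgt γ) ∨ (X = C.tgt γ ∧ Y = C.src γ)) := by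
  constructor
  · rintro ⟨h, d, rfl, rfl, rfl⟩
    exact ⟨h, ends_of_mem h⟩
  · rintro ⟨h, ⟨rfl, rfl⟩ | ⟨rfl, rfl⟩⟩
    · exact ⟨h, Quot.out γ, curve_out γ, rfl, rfl⟩
    · refine ⟨h, S.rev (Quot.out γ), by rw [S.curve_rev, curve_out], rfl, ?_⟩
      rw [S.rev_rev]
      rfl

variable {C}

/-- Both relations are reflexive on all pieces, including those outside the vertex set of `T`, so
only the edges of `T` count. -/
theorem joined_iff {T : Graph C.Piece S.Curve} (hT : T ≤ C.dualGraph) {X Y : C.Piece} :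
    Joined T X Y ↔ LinkedBy C.src C.tgt T.edgeSet X Y := by
  constructor
  · intro h
    induction h with
    | refl => exact .refl _
    | tail _ h ih =>
      obtain ⟨γ, hγ⟩ := h
      refine ih.trans ?_
      rcases (C.dualGraph_isLink_iff.1 (hγ.mono hT)).2 with ⟨rfl, rfl⟩ | ⟨rfl, rfl⟩
      · exact .of_mem hγ.edge_mem
      · exact (LinkedBy.of_mem hγ.edge_mem).symm
  · have symm : ∀ {X Y}, Joined T X Y → Joined T Y X := fun h => by
      induction h with
      | refl => exact .refl
      | tail _ h ih => exact .head h.symm ih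
    intro h
    induction h with
    | rel x y h =>
      obtain ⟨γ, hγ, rfl, rfl⟩ := h
      refine .single ⟨γ, (hT.isLink_iff hγ).2 ?_⟩
      exact C.dualGraph_isLink_iff.2 ⟨hT.edgeSet_mono hγ, .inl ⟨rfl, rfl⟩⟩
    | refl x => exact .refl
    | symm x y _ ih => exact symm ih
    | trans x y z _ _ ih ih' => exact Relation.ReflTransGen.trans ih ih'

theorem isForest_iff {T : Graph C.Piece S.Curve} (hT : T ≤ C.dualGraph) :
    IsForest T ↔ Acyclic C.src C.tgt T.edgeSet := by
  have hd : ∀ γ, T.deleteEdges {γ} ≤ C.dualGraph := fun γ => Graph.deleteEdges_le.trans hT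
  constructor
  · intro h γ hγ hl
    refine h γ _ _ ((hT.isLink_iff hγ).2
      (C.dualGraph_isLink_iff.2 ⟨hT.edgeSet_mono hγ, .inl ⟨rfl, rfl⟩⟩)) ?_
    rwa [joined_iff (hd γ), Graph.edgeSet_deleteEdges]
  · intro h γ X Y hl hj
    rw [joined_iff (hd γ), Graph.edgeSet_deleteEdges] at hj
    rcases (C.dualGraph_isLink_iff.1 (hl.mono hT)).2 with ⟨rfl, rfl⟩ | ⟨rfl, rfl⟩
    · exact h γ hl.edge_mem hj
    · exact h γ hl.edge_mem hj.symm

/-- The dual graph is connected because the surface is. -/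
theorem linkedBy_curves (X Y : C.Piece) : LinkedBy C.src C.tgt C.curves X Y := by
  induction X using Quot.ind with
  | mk R =>
  induction Y using Quot.ind with
  | mk R' =>
  induction S.connected R R' with
  | rel x y h =>
    obtain ⟨d, rfl, rfl⟩ := h
    change LinkedBy _ _ _ (S.piece C.curves (S.left d)) (S.piece C.curves (S.left (S.rev d)))
    by_cases hd : S.curve d ∈ C.curves
    · rcases ends_of_mem hd with ⟨h1, h2⟩ | ⟨h1, h2⟩ <;> rw [h1, h2]
      · exact .of_mem hd
      · exact (LinkedBy.of_mem hd).symm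
    · rw [piece_left_rev hd]
      exact .refl _
  | refl x => exact .refl _
  | symm x y _ ih => exact ih.symm
  | trans x y z _ _ ih ih' => exact ih.trans ih'

/-! ### Edge sets of the reducing graphs, and the compression bodies they preserve -/

variable (C)

/-- `F` is the edge set of an element of `𝒜(C)`. -/
structure IsReducing (F : Set S.Curve) : Prop where
  subset : F ⊆ C.curves
  acyclic : Acyclic C.src C.tgt F
  linkedBy : C.positivePieces = ∅ → ∀ X Y, LinkedBy C.src C.tgt F X Y
  existsUnique : C.positivePieces.Nonempty →
    ∀ X, ∃! Y, Y ∈ C.positivePieces ∧ LinkedBy C.src C.tgt F X Y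

theorem exists_isReducing : ∃ F, C.IsReducing F := by
  rcases C.positivePieces.eq_empty_or_nonempty with h | h
  -- With no component of positive genus, any single marked vertex turns the extension lemma into
  -- the existence of a spanning tree.
  · obtain ⟨X₀⟩ : Nonempty C.Piece := inferInstance
    obtain ⟨F, -, h1, h2, h3⟩ := exists_acyclic_extension (P := {X₀}) linkedBy_curves ⟨X₀, rfl⟩
      (Set.empty_subset _) acyclic_empty (by rintro _ rfl _ rfl _; rfl)
    refine ⟨F, h1, h2, fun _ X Y => ?_, fun h' => absurd h h'.ne_empty⟩
    obtain ⟨_, ⟨rfl, hX⟩, -⟩ := h3 X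
    obtain ⟨_, ⟨rfl, hY⟩, -⟩ := h3 Y
    exact hX.trans hY.symm
  · obtain ⟨F, -, h1, h2, h3⟩ := exists_acyclic_extension linkedBy_curves h
      (Set.empty_subset _) acyclic_empty fun p _ q _ hpq => by
        have h0 : ∀ X Y, LinkedBy C.src C.tgt ∅ X Y → X = Y := by
          intro X Y h
          induction h with
          | rel x y h => exact h.elim fun _ h => h.1.elim
          | refl x => rfl
          | symm x y _ ih => exact ih.symm
          | trans x y z _ _ ih ih' => exact ih.trans ih'
        exact h0 p q hpq
    exact ⟨F, h1, h2, fun h' => absurd h' h.ne_empty, fun _ => h3⟩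

variable {C}

theorem isReducing_edgeSet {T : Graph C.Piece S.Curve} (hT : T ∈ C.reducingGraphs) :
    C.IsReducing T.edgeSet := by
  obtain ⟨hle, h1, h2⟩ := hT
  rcases C.positivePieces.eq_empty_or_nonempty with h | h
  · obtain ⟨⟨-, ⟨X₀, hX₀⟩, hj, hf⟩, hmax⟩ := h1 h
    -- A maximal tree is not assumed to be spanning. Its edges extend to a spanning tree, and
    -- maximality forces equality.
    obtain ⟨F, hF, h1, h2, h3⟩ := exists_acyclic_extension (P := {X₀}) linkedBy_curves ⟨X₀, rfl⟩
      hle.edgeSet_mono ((isForest_iff hle).1 hf) (by rintro _ rfl _ rfl _; rfl)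
    have h4 : ∀ X Y, LinkedBy C.src C.tgt F X Y := by
      intro X Y
      obtain ⟨_, ⟨rfl, hX⟩, -⟩ := h3 X
      obtain ⟨_, ⟨rfl, hY⟩, -⟩ := h3 Y
      exact hX.trans hY.symm
    have hE : (C.dualGraph.restrict F).edgeSet = F := by
      rw [Graph.edgeSet_restrict]
      exact Set.inter_eq_right.2 h1
    have hle' : C.dualGraph.restrict F ≤ C.dualGraph := Graph.restrict_le
    have hT' : T ≤ C.dualGraph.restrict F :=
      ⟨fun _ _ => Set.mem_univ _, fun γ X Y hl => ⟨hF hl.edge_mem, hl.mono hle⟩⟩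
    have h5 := hmax ⟨hle', ⟨X₀, Set.mem_univ _⟩, fun X _ Y _ => by
      rw [joined_iff hle', hE]
      exact h4 X Y, by rwa [isForest_iff hle', hE]⟩ hT'
    have h6 : T.edgeSet = F := by
      refine hF.antisymm ?_
      have := h5.edgeSet_mono
      rwa [hE] at this
    rw [h6]
    exact ⟨h1, h2, fun _ => h4, fun h' => absurd h h'.ne_empty⟩
  · obtain ⟨hV, hf, hu⟩ := h2 h
    refine ⟨hle.edgeSet_mono, (isForest_iff hle).1 hf, fun h' => absurd h' h.ne_empty,
      fun _ X => ?_⟩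
    have := hu X (hV ▸ Set.mem_univ X)
    simpa only [joined_iff hle] using this

theorem IsReducing.exists_graph {F : Set S.Curve} (hF : C.IsReducing F) :
    ∃ T ∈ C.reducingGraphs, T.edgeSet = F := by
  have hE : (C.dualGraph.restrict F).edgeSet = F := by
    rw [Graph.edgeSet_restrict]
    exact Set.inter_eq_right.2 hF.subset
  have hle : C.dualGraph.restrict F ≤ C.dualGraph := Graph.restrict_le
  have hfor : IsForest (C.dualGraph.restrict F) := by
    rw [isForest_iff hle, hE]
    exact hF.acyclic
  refine ⟨_, ⟨hle, fun h => ⟨⟨hle, ⟨Classical.arbitrary _, Set.mem_univ _⟩, fun X _ Y _ => ?_, hfor⟩,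
    ?_⟩, fun h => ⟨rfl, hfor, fun X _ => ?_⟩⟩, hE⟩
  · rw [joined_iff hle, hE]
    exact hF.linkedBy h X Y
  -- An additional edge of a larger tree would join two vertices already linked by `F`.
  · rintro T' ⟨hT', -, -, hf⟩ hle'
    refine ⟨fun _ _ => Set.mem_univ _, fun γ X Y hl => ⟨by_contra fun hγ => ?_, hl.mono hT'⟩⟩
    have hmono := hle'.edgeSet_mono
    rw [hE] at hmono
    refine (isForest_iff hT').1 hf γ hl.edge_mem ((hF.linkedBy h _ _).mono ?_)
    exact fun γ' hγ' => ⟨hmono hγ', fun h => hγ (h ▸ hγ')⟩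
  · simp only [joined_iff hle, hE]
    exact hF.existsUnique h X

/-- In a reduced system an edge of `F` would be a loop: either there is only one vertex, or every
vertex has positive genus and no component of `F` may contain two of them. -/
theorem IsReducing.eq_empty_of_isReduced {F : Set S.Curve} (hF : C.IsReducing F)
    (hC : C.IsReduced) : F = ∅ := by
  rw [Set.eq_empty_iff_forall_notMem]
  intro γ hγ
  have h : C.src γ = C.tgt γ := by
    rcases hC with h | h
    · exact (Nat.card_eq_one_iff_unique.1 h).1.elim _ _
    · exact (hF.existsUnique ⟨C.src γ, h _⟩ (C.src γ)).unique ⟨h _, .refl _⟩ ⟨h _, .of_mem hγ⟩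
  apply hF.acyclic γ hγ
  rw [← h]
  exact .refl _

theorem finsum_genus_eq {s : Set C.Piece} {Y : C.Piece} (hY : Y ∈ s)
    (h : ∀ X ∈ s, X ≠ Y → C.genus X = 0) : ∑ᶠ X ∈ s, C.genus X = C.genus Y := by
  rw [finsum_mem_eq_finite_toFinset_sum _ (Set.toFinite s)]
  apply Finset.sum_eq_single
  · intro X hX hne
    exact h X (by simpa using hX) hne
  · intro hY'
    simp [hY] at hY'

/-- For a forest genera add up under merging. If positive genera occur, each merged component
inherits the genus of its unique positive member; otherwise everything merges into one sphere. -/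
theorem IsReducing.sameCompressionBody_and_isReduced {F : Set S.Curve} (hF : C.IsReducing F) :
    (C.remove F).SameCompressionBody C ∧ (C.remove F).IsReduced := by
  have hg : ∀ X, (C.remove F).genus (C.merge F X) =
      ∑ᶠ Y ∈ {Y | LinkedBy C.src C.tgt F X Y}, C.genus Y := fun X => by
    rw [C.genus_merge hF.subset, hF.acyclic.excess_eq_zero, add_zero]
  rcases C.positivePieces.eq_empty_or_nonempty with h | h
  · have h0 : ∀ X, C.genus X = 0 := fun X =>
      by_contra fun hX => (Set.eq_empty_iff_forall_notMem.1 h X) hX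
    have h0' : ∀ Z, (C.remove F).genus Z = 0 := by
      intro Z
      obtain ⟨X, rfl⟩ := C.merge_surjective F Z
      rw [hg, finsum_genus_eq (s := {Y | LinkedBy C.src C.tgt F X Y}) (Y := X) (.refl _) fun Y _ _ => h0 Y, h0]
    refine ⟨fun g hg => ?_, .inl ?_⟩
    · simp [negativeBoundaryCount, h0, h0', hg.symm]
    · rw [Nat.card_eq_one_iff_unique]
      refine ⟨⟨fun Z Z' => ?_⟩, inferInstance⟩
      obtain ⟨X, rfl⟩ := C.merge_surjective F Z
      obtain ⟨X', rfl⟩ := C.merge_surjective F Z'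
      exact (C.merge_eq_iff hF.subset).2 (hF.linkedBy h X X')
  · have hu := hF.existsUnique h
    have key : ∀ X Y, Y ∈ C.positivePieces → LinkedBy C.src C.tgt F X Y →
        (C.remove F).genus (C.merge F X) = C.genus Y := by
      intro X Y hY hXY
      rw [hg, finsum_genus_eq (s := {Y | LinkedBy C.src C.tgt F X Y}) (Y := Y) hXY]
      intro Y' hY' hne
      by_contra h0
      exact hne ((hu X).unique ⟨h0, hY'⟩ ⟨hY, hXY⟩)
    refine ⟨fun g hg => ?_, .inr fun Z => ?_⟩
    · have himg : {Z | (C.remove F).genus Z = g} = C.merge F '' {X | C.genus X = g} := by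
        ext Z
        constructor
        · intro hZ
          obtain ⟨X, rfl⟩ := C.merge_surjective F Z
          obtain ⟨Y, ⟨hY, hXY⟩, -⟩ := hu X
          exact ⟨Y, (key X Y hY hXY).symm.trans hZ, ((C.merge_eq_iff hF.subset).2 hXY).symm⟩
        · rintro ⟨X, rfl, rfl⟩
          exact key X X hg (.refl _)
      rw [negativeBoundaryCount, negativeBoundaryCount, himg, Set.InjOn.ncard_image]
      rintro X rfl Y hY hXY
      rw [C.merge_eq_iff hF.subset] at hXY
      exact (hu X).unique ⟨hg, .refl _⟩ ⟨fun h => hg (hY.symm.trans h), hXY⟩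
    · obtain ⟨X, rfl⟩ := C.merge_surjective F Z
      obtain ⟨Y, ⟨hY, hXY⟩, -⟩ := hu X
      rw [key X Y hY hXY]
      exact hY

/-- The total genus is preserved, yet it grows by the sum of the excesses of the merged components.
Being nonnegative, these all vanish. -/
theorem acyclic_of_sameCompressionBody {F : Set S.Curve} (hF : F ⊆ C.curves)
    (h : (C.remove F).SameCompressionBody C) : Acyclic C.src C.tgt F := by
  classical
  have := Fintype.ofFinite C.Piece
  have := Fintype.ofFinite (C.remove F).Piece
  have h1 : ∑ Z, (C.remove F).genus Z = ∑ X, C.genus X := sum_comp_eq_sum_comp h id rfl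
  choose σ hσ using C.merge_surjective F
  have h2 : ∀ Z, (C.remove F).genus Z = ∑ X with C.merge F X = Z, C.genus X +
      excess C.src C.tgt F (σ Z) := by
    intro Z
    have h3 := C.genus_merge hF (σ Z)
    rw [hσ, finsum_mem_eq_finite_toFinset_sum _ (Set.toFinite _)] at h3
    rw [h3]
    congr 2
    ext X
    simp only [Set.Finite.mem_toFinset, Set.mem_ofPred_eq, Finset.mem_filter, Finset.mem_univ,
      true_and]
    rw [← C.merge_eq_iff hF, hσ, eq_comm]
  rw [Finset.sum_congr rfl fun Z _ => h2 Z, Finset.sum_add_distrib,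
    Finset.sum_fiberwise Finset.univ (C.merge F) C.genus,
    add_eq_left, Finset.sum_eq_zero_iff_of_nonneg fun Z _ => excess_nonneg F _] at h1
  refine acyclic_of_excess_eq_zero fun X => ?_
  rw [← h1 (C.merge F X) (Finset.mem_univ _)]
  exact excess_congr ((C.merge_eq_iff hF).1 (hσ _).symm)

/-- When positive genera occur, reducedness makes every merged component positive, so each contains
an old positive one. There are equally many of both, hence exactly one in each. -/
theorem isReducing_of_sameCompressionBody {F : Set S.Curve} (hF : F ⊆ C.curves)
    (h : (C.remove F).SameCompressionBody C) (hr : (C.remove F).IsReduced) : C.IsReducing F := by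
  classical
  have := Fintype.ofFinite C.Piece
  have := Fintype.ofFinite (C.remove F).Piece
  have hac := acyclic_of_sameCompressionBody hF h
  have hg : ∀ X, (C.remove F).genus (C.merge F X) =
      ∑ᶠ Y ∈ {Y | LinkedBy C.src C.tgt F X Y}, C.genus Y := fun X => by
    rw [C.genus_merge hF, hac.excess_eq_zero, add_zero]
  refine ⟨hF, hac, fun hP X Y => ?_, fun hP => ?_⟩
  · have h0 : ∀ X, C.genus X = 0 := fun X =>
      by_contra fun hX => (Set.eq_empty_iff_forall_notMem.1 hP X) hX
    have h1 : (C.remove F).genus (C.merge F X) = 0 := by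
      rw [hg, finsum_genus_eq (s := {Y | LinkedBy C.src C.tgt F X Y}) (Y := X) (.refl _) fun Y _ _ => h0 Y, h0]
    rcases hr with hr | hr
    · exact (C.merge_eq_iff hF).1 ((Nat.card_eq_one_iff_unique.1 hr).1.elim _ _)
    · exact absurd h1 (hr _)
  · have hne : ∀ Z, (C.remove F).genus Z ≠ 0 := by
      rcases hr with hr | hr
      -- A single merged component could be a sphere a priori, but some component must have the
      -- positive genus of `X`.
      · obtain ⟨X, hX⟩ := hP
        have h1 : {Y | C.genus Y = C.genus X}.ncard ≠ 0 :=
          Set.ncard_ne_zero_of_mem (a := X) rfl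
        rw [← negativeBoundaryCount, ← h _ hX] at h1
        obtain ⟨Z, hZ⟩ := Set.nonempty_of_ncard_ne_zero h1
        intro Z'
        rw [(Nat.card_eq_one_iff_unique.1 hr).1.elim Z' Z, show _ = _ from hZ]
        exact hX
      · exact hr
    have hex : ∀ X, ∃ Y ∈ C.positivePieces, LinkedBy C.src C.tgt F X Y := by
      intro X
      by_contra hno
      push Not at hno
      apply hne (C.merge F X)
      have h0 : ∀ Y, LinkedBy C.src C.tgt F X Y → C.genus Y = 0 := fun Y hY =>
        by_contra fun h' => hno Y h' hY
      rw [hg, finsum_genus_eq (s := {Y | LinkedBy C.src C.tgt F X Y}) (Y := X) (.refl _) fun Y hY _ => h0 Y hY, h0 X (.refl _)]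
    have hcard : Nat.card C.positivePieces ≤ Nat.card (C.remove F).Piece := by
      have := sum_comp_eq_sum_comp h (fun g => if g = 0 then 0 else 1) rfl
      simp only [hne, if_false, Finset.sum_const, Finset.card_univ, nsmul_eq_mul, mul_one] at this
      have hpos : Nat.card C.positivePieces =
          (Finset.univ.filter fun X => ¬ C.genus X = 0).card := by
        rw [Nat.card_coe_set_eq, ← Set.ncard_coe_finset]
        congr 1
        ext X
        simp [positivePieces]
      rw [hpos, Nat.card_eq_fintype_card, ← Nat.cast_le (α := ℤ), this, Finset.sum_ite]
      simp
    have hbij := Function.Surjective.bijective_of_nat_card_le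
      (f := fun X : C.positivePieces => C.merge F X) (by
        intro Z
        obtain ⟨X, rfl⟩ := C.merge_surjective F Z
        obtain ⟨Y, hY, hXY⟩ := hex X
        exact ⟨⟨Y, hY⟩, ((C.merge_eq_iff hF).2 hXY).symm⟩) hcard
    intro X
    obtain ⟨Y, hY, hXY⟩ := hex X
    refine ⟨Y, ⟨hY, hXY⟩, fun Y' ⟨hY', hXY'⟩ => ?_⟩
    have := @hbij.1 ⟨Y', hY'⟩ ⟨Y, hY⟩ ((C.merge_eq_iff hF).2 (hXY'.symm.trans hXY))
    exact congrArg Subtype.val this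

/-- With one component every curve is a loop of the dual graph, and an acyclic set contains no
loops. -/
theorem eq_empty_of_sameCompressionBody_of_card_eq_one {F : Set S.Curve} (hF : F ⊆ C.curves)
    (hC : Nat.card C.Piece = 1) (h : (C.remove F).SameCompressionBody C) : F = ∅ := by
  rw [Set.eq_empty_iff_forall_notMem]
  intro γ hγ
  apply acyclic_of_sameCompressionBody hF h γ hγ
  rw [(Nat.card_eq_one_iff_unique.1 hC).1.elim (C.src γ) (C.tgt γ)]
  exact .refl _

end CurveSystem

open CurvedSurface

variable {S : CurvedSurface}

theorem CurveSystem.ext {i : Bool} {C D : CurveSystem S i} (h : C.curves = D.curves) : C = D := by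
  cases C
  cases D
  cases h
  rfl

namespace Diagram

variable (H : Diagram S)

/-! ## Removing curves from a diagram -/

/-- The diagram obtained by removing the curves in `F` from the second system. -/
def removeCurves (F : Set S.Curve) : Diagram S where
  fst := H.fst
  snd := H.snd.remove F

theorem removeCurves_empty : H.removeCurves ∅ = H := by
  have h : H.snd.remove ∅ = H.snd := CurveSystem.ext Set.sdiff_empty
  rw [removeCurves, h]

/-- A singular vertex lies on exactly one curve of the second system; it disappears precisely when
that curve is removed, and is counted for no other curve. -/
theorem complexity_eq_add {F : Set S.Curve} (hF : F ⊆ H.snd.curves) :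
    H.complexity = (H.removeCurves F).complexity + ∑ᶠ γ ∈ F, H.curveVertexCount γ := by
  have hfin := Set.toFinite F
  have same : ∀ {d e : S.Dart}, S.vertex d = S.vertex e → S.curve d ∈ H.snd.curves →
      S.curve e ∈ H.snd.curves → S.curve d = S.curve e := by
    intro d e h hd he
    have hc := (H.snd.colour_eq e he).trans (H.snd.colour_eq d hd).symm
    rcases vertex_eq_and_colour_eq_iff.1 ⟨h, hc⟩ with rfl | rfl
    · rfl
    · exact (curve_opp d).symm
  let A : Set S.Dart := {d | S.vertex d ∈ H.singularVertices ∧ S.curve d ∈ H.snd.curves}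
  have h := ncard_image_fiberwise (A := A) (q := S.vertex) (l := S.curve)
    (fun d hd e he h => same h hd.2 he.2) hfin.toFinset
  rw [finsum_mem_eq_finite_toFinset_sum _ hfin]
  have h1 : ∀ γ ∈ hfin.toFinset,
      (S.vertex '' {d ∈ A | S.curve d = γ}).ncard = H.curveVertexCount γ := by
    intro γ hγ
    rw [hfin.mem_toFinset] at hγ
    unfold curveVertexCount
    congr 1
    ext v
    constructor
    · rintro ⟨d, ⟨h1, h2⟩, rfl⟩
      exact ⟨h1.1, d, rfl, h2⟩
    · rintro ⟨h1, d, rfl, rfl⟩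
      exact ⟨d, ⟨⟨h1, hF hγ⟩, rfl⟩, rfl⟩
  rw [← Finset.sum_congr rfl h1, ← h, complexity, complexity, ← Set.ncard_union_eq]
  · congr 1
    ext v
    constructor
    · rintro ⟨d, e, rfl, he, h1, h2⟩
      by_cases h3 : S.curve e ∈ F
      · exact .inr ⟨e, ⟨⟨⟨d, e, he.symm, rfl, h1, h2⟩, h2⟩, hfin.mem_toFinset.2 h3⟩, he⟩
      · exact .inl ⟨d, e, rfl, he, h1, h2, h3⟩
    · rintro (⟨d, e, rfl, he, h1, h2⟩ | ⟨d, ⟨⟨h1, _⟩, _⟩, rfl⟩)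
      · exact ⟨d, e, rfl, he, h1, h2.1⟩
      · exact h1
  · rw [Set.disjoint_left]
    rintro _ ⟨d, e, rfl, he, h1, h2⟩ ⟨f, ⟨⟨_, h3⟩, h4⟩, hf⟩
    rw [hfin.mem_toFinset, same (hf.trans he.symm) h3 h2.1] at h4
    exact h2.2 h4

variable {H}

theorem removeCurves_mem_Rd (hfst : Nat.card H.fst.Piece = 1) {F : Set S.Curve}
    (hF : H.snd.IsReducing F) : H.removeCurves F ∈ H.Rd :=
  ⟨subset_rfl, Set.sdiff_subset, fun _ _ => rfl, hF.sameCompressionBody_and_isReduced.1, .inl hfst,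
    hF.sameCompressionBody_and_isReduced.2⟩

theorem Rd_eq (hfst : Nat.card H.fst.Piece = 1) :
    H.Rd = H.removeCurves '' {F | H.snd.IsReducing F} := by
  refine Set.Subset.antisymm ?_ ?_
  · rintro ⟨C, D⟩ ⟨h1, h2, h3, h4, -, h5⟩
    have e : ∀ {i : Bool} {A B : CurveSystem S i}, A.curves ⊆ B.curves →
        B.remove (B.curves \ A.curves) = A := fun h =>
      CurveSystem.ext (Set.sdiff_sdiff_cancel_left h)
    have hC := e h1
    have hD := e h2
    dsimp only at h1 h2 h3 h4 h5 hC hD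
    rw [← hC] at h3
    rw [CurveSystem.eq_empty_of_sameCompressionBody_of_card_eq_one Set.sdiff_subset hfst h3] at hC
    rw [← hD] at h4 h5
    refine ⟨_, CurveSystem.isReducing_of_sameCompressionBody Set.sdiff_subset h4 h5, ?_⟩
    rw [removeCurves, hD, ← hC]
    exact congrArg (fun C => Diagram.mk C D) (CurveSystem.ext Set.sdiff_empty.symm)
  · rintro _ ⟨F, hF, rfl⟩
    exact removeCurves_mem_Rd hfst hF

theorem modifiedComplexity_eq_sInf (hfst : Nat.card H.fst.Piece = 1) :
    H.modifiedComplexity = sInf (reducedModifiedComplexity '' H.Rd) := by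
  unfold modifiedComplexity
  split_ifs with h
  -- A reducing set of a reduced system is empty, so the minimum over `Rd` also gives the right
  -- value for a reduced diagram.
  · have : H.Rd = {H} := by
      rw [Rd_eq hfst]
      refine Set.Subset.antisymm ?_ ?_
      · rintro _ ⟨F, hF, rfl⟩
        rw [CurveSystem.IsReducing.eq_empty_of_isReduced hF h.2, removeCurves_empty]
        rfl
      · rw [Set.singleton_subset_iff]
        obtain ⟨F, hF⟩ := H.snd.exists_isReducing
        refine ⟨F, hF, ?_⟩
        rw [hF.eq_empty_of_isReduced h.2, removeCurves_empty]
    rw [this, Set.image_singleton, csInf_singleton]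
  · rfl

theorem reducedModifiedComplexity_removeCurves {F : Set S.Curve} (hF : F ⊆ H.snd.curves) :
    ∃ R : (H.removeCurves F).Region,
      (∀ R', (H.removeCurves F).regionVertexCount R' ≤ (H.removeCurves F).regionVertexCount R) ∧
      (H.removeCurves F).reducedModifiedComplexity = (H.complexity : ℤ) -
        ((H.removeCurves F).regionVertexCount R + ∑ᶠ γ ∈ F, H.curveVertexCount γ : ℕ) := by
  -- Finitely many regions, and at least one, so the supremum in `ℕ` is attained and is not a
  -- default value.
  obtain ⟨R, hR⟩ := exists_eq_ciSup_of_finite (f := (H.removeCurves F).regionVertexCount)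
  refine ⟨R, fun R' => ?_, ?_⟩
  · rw [hR]
    exact le_ciSup (Set.finite_range _).bddAbove R'
  · rw [reducedModifiedComplexity, ← hR, H.complexity_eq_add hF]
    push_cast
    ring

theorem modifiedComplexity_eq (hfst : Nat.card H.fst.Piece = 1) :
    (∀ T ∈ H.snd.reducingGraphs, H.removeEdges T ∈ H.Rd) ∧
    ∃ M : ℕ,
      IsGreatest {m : ℕ | ∃ T ∈ H.snd.reducingGraphs, ∃ R : (H.removeEdges T).Region,
        m = (H.removeEdges T).regionVertexCount R + ∑ᶠ γ ∈ T.edgeSet, H.curveVertexCount γ} M ∧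
      H.modifiedComplexity = (H.complexity : ℤ) - M := by
  refine ⟨fun T hT => removeCurves_mem_Rd hfst (CurveSystem.isReducing_edgeSet hT), ?_⟩
  let K := {m : ℕ | ∃ F, H.snd.IsReducing F ∧ ∃ R : (H.removeCurves F).Region,
    m = (H.removeCurves F).regionVertexCount R + ∑ᶠ γ ∈ F, H.curveVertexCount γ}
  have hK : {m : ℕ | ∃ T ∈ H.snd.reducingGraphs, ∃ R : (H.removeEdges T).Region,
      m = (H.removeEdges T).regionVertexCount R + ∑ᶠ γ ∈ T.edgeSet, H.curveVertexCount γ} = K := by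
    ext m
    constructor
    · rintro ⟨T, hT, R, hm⟩
      exact ⟨T.edgeSet, CurveSystem.isReducing_edgeSet hT, R, hm⟩
    · rintro ⟨F, hF, hR⟩
      obtain ⟨T, hT, rfl⟩ := hF.exists_graph
      exact ⟨T, hT, hR⟩
  have hbdd : BddAbove K := by
    let f : (Σ F : Set S.Curve, (H.removeCurves F).Region) → ℕ := fun x =>
      (H.removeCurves x.1).regionVertexCount x.2 + ∑ᶠ γ ∈ x.1, H.curveVertexCount γ
    refine (Set.finite_range f).bddAbove.mono ?_
    rintro _ ⟨F, _, R, rfl⟩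
    exact ⟨⟨F, R⟩, rfl⟩
  have hne : K.Nonempty := by
    obtain ⟨F, hF⟩ := H.snd.exists_isReducing
    exact ⟨_, F, hF, Classical.arbitrary _, rfl⟩
  have hgr : IsGreatest K (sSup K) := ⟨Nat.sSup_mem hne hbdd, fun m hm => le_csSup hbdd hm⟩
  rw [hK]
  refine ⟨sSup K, hgr, ?_⟩
  rw [modifiedComplexity_eq_sInf hfst, Rd_eq hfst]
  apply IsLeast.csInf_eq
  constructor
  -- The maximising region `R` may be replaced by the largest region `R'` for the same `F`;
  -- maximality of the total makes the two counts agree.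
  · obtain ⟨F, hF, R, hM⟩ := hgr.1
    obtain ⟨R', hR', h⟩ := H.reducedModifiedComplexity_removeCurves hF.subset
    refine ⟨_, ⟨F, hF, rfl⟩, ?_⟩
    have h1 := hgr.2 ⟨F, hF, R', rfl⟩
    have h2 := hR' R
    omega
  · rintro _ ⟨_, ⟨F, hF, rfl⟩, rfl⟩
    obtain ⟨R', _, h⟩ := H.reducedModifiedComplexity_removeCurves hF.subset
    have h1 := hgr.2 ⟨F, hF, R', rfl⟩
    omega

end Diagram

/-! ## The closed Dunwoody diagram -/

section Closed

variable (a b c n : ℕ) (r s : ℤ) (hn : 0 < n) (hd : 0 < 2 * a + b + c)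

theorem curve_mem_closedDiagram_fst {d : (closedSurface a b c n r s hn hd).Dart}
    (h : (closedSurface a b c n r s hn hd).colour d = true) :
    (closedSurface a b c n r s hn hd).curve d ∈ (closedDiagram a b c n r s hn hd).fst.curves :=
  fun _ he => (colour_eq_of_curve_eq he).trans h

theorem curve_mem_closedDiagram_snd {d : (closedSurface a b c n r s hn hd).Dart}
    (h : (closedSurface a b c n r s hn hd).colour d = false) :
    (closedSurface a b c n r s hn hd).curve d ∈ (closedDiagram a b c n r s hn hd).snd.curves :=
  fun _ he => (colour_eq_of_curve_eq he).trans h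

/-- Every vertex of the closed diagram is a crossing of a circle with an arc, and vertices
correspond to the pairs `(i, k)`. -/
theorem complexity_closedDiagram :
    (closedDiagram a b c n r s hn hd).complexity = n * (2 * a + b + c) := by
  have h1 : (closedDiagram a b c n r s hn hd).singularVertices = Set.univ := by
    rw [Set.eq_univ_iff_forall]
    intro v
    induction v using Quot.ind with
    | mk d =>
    rcases hcol : (closedSurface a b c n r s hn hd).colour d with _ | _
    all_goals
      have hrot : (closedSurface a b c n r s hn hd).colour
          ((closedSurface a b c n r s hn hd).rot d) =
          !(closedSurface a b c n r s hn hd).colour d := by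
        obtain ⟨p, _ | _ | _ | _⟩ := d <;> rfl
      rw [hcol] at hrot
    · exact ⟨_, d, vertex_rot d, rfl, curve_mem_closedDiagram_fst _ _ _ _ _ _ _ _ hrot,
        curve_mem_closedDiagram_snd _ _ _ _ _ _ _ _ hcol⟩
    · exact ⟨d, _, rfl, vertex_rot d, curve_mem_closedDiagram_fst _ _ _ _ _ _ _ _ hcol,
        curve_mem_closedDiagram_snd _ _ _ _ _ _ _ _ hrot⟩
  let f : (closedSurface a b c n r s hn hd).Vertex ≃ ZMod n × ZMod (2 * a + b + c) :=
    { toFun := Quot.lift Prod.fst (by rintro d _ rfl; rfl)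
      invFun := fun p => (closedSurface a b c n r s hn hd).vertex (p, .inner)
      left_inv := by
        intro v
        induction v using Quot.ind with
        | mk d =>
        obtain ⟨p, x⟩ := d
        apply vertex_eq_iff.2
        cases x
        exacts [.inl rfl, .inr (.inl rfl), .inr (.inr (.inl rfl)), .inr (.inr (.inr rfl))]
      right_inv := fun _ => rfl }
  rw [Diagram.complexity, h1, Set.ncard_univ, Nat.card_congr f, Nat.card_prod, Nat.card_zmod,
    Nat.card_zmod]

/-- Only arcs may be crossed now, not circles. Crossing the arcs at one circle links all regions
around it. All internal circles touch the upper region, and each external circle touches `meridian i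
(a + b)`, which also touches an internal one. -/
theorem card_piece_closedDiagram_fst :
    Nat.card (closedDiagram a b c n r s hn hd).fst.Piece = 1 := by
  have : NeZero (2 * a + b + c) := ⟨hd.ne'⟩
  let q : PlanarRegion a b c n → (closedDiagram a b c n r s hn hd).fst.Piece :=
    (closedSurface a b c n r s hn hd).piece (closedDiagram a b c n r s hn hd).fst.curves
  have step : ∀ e : ArcEnd a b c n, q (endLeft hd e) = q (endRight hd e) := by
    intro e
    have h := piece_left_rev (S := closedSurface a b c n r s hn hd)
      (C := (closedDiagram a b c n r s hn hd).fst.curves) (d := dartOfEnd a b c n r s e) fun h => by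
        have h1 := h _ rfl
        rw [show (closedSurface a b c n r s hn hd).colour (dartOfEnd a b c n r s e) = false from
          dColour_dartOfEnd r s e] at h1
        cases h1
    change q (dLeft r s hd (dRev a b c n r s (dartOfEnd a b c n r s e))) =
      q (dLeft r s hd (dartOfEnd a b c n r s e)) at h
    rw [dRev_dartOfEnd, dLeft_dartOfEnd, dLeft_dartOfEnd, endLeft_otherEnd] at h
    exact h.symm
  have gap : ∀ (t : Bool) (i : ZMod n) (k : ℕ) (hk : k ≤ 2 * a + b + c),
      q (gapNat a b c t i k hk) = q (gapNat a b c t i 0 (by omega)) := by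
    intro t i k hk
    induction k with
    | zero => rfl
    | succ k ih =>
      have e1 : ((k : ℕ) : ZMod (2 * a + b + c)).val = k := ZMod.val_cast_of_lt (by omega)
      have h := step (t, i, (k : ZMod (2 * a + b + c)))
      have g1 : gapNat a b c t i _ (ZMod.val_lt (k : ZMod (2 * a + b + c))).le =
        gapNat a b c t i k (by omega) := gapNat_congr e1
      have g2 : gapNat a b c t i _ (ZMod.val_lt (k : ZMod (2 * a + b + c))) =
        gapNat a b c t i (k + 1) hk := gapNat_congr (by rw [e1])
      rw [← ih (by omega), ← g1, ← g2]
      cases t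
      · exact h.symm
      · exact h
  have up : ∀ (i : ZMod n) (k : ℕ) (hk : k ≤ 2 * a + b + c),
      q (gapNat a b c true i k hk) = q (meridianRegion a b c 0 0 (by omega)) := by
    intro i k hk
    rw [gap, (gap_true_low (j := 0) (hj := by omega) (by omega) rfl).trans (meridian_zero rfl rfl)]
  have low : ∀ (i : ZMod n) (j : ℕ) (hj : j ≤ 2 * a + b), j ≤ a + b →
      q (meridianRegion a b c i j hj) = q (meridianRegion a b c 0 0 (by omega)) := by
    intro i j hj h
    rw [← up i j (by omega), gap_true_low (j := j) (hj := hj) h rfl]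
  have all : ∀ R, q R = q (meridianRegion a b c 0 0 (by omega)) := by
    intro R
    induction R using Quot.ind with
    | mk x =>
    cases x with
    | meridian i j =>
      have hj := j.2
      by_cases h : j.val ≤ a + b
      · exact low i j.val (by omega) h
      · change q (meridianRegion a b c i j.val (by omega)) = _
        rw [← gap_false_low (k := 2 * a + b - j.val) (hk := by omega) (by omega) (by omega), gap,
          ← gap false i a (by omega),
          gap_false_low (j := a + b) (hj := by omega) le_rfl (by omega)]
        exact low i (a + b) (by omega) le_rfl
    | transverse i j =>
      have hj := j.2
      rw [← up i (a + b + j.val) (by omega), gap_true_mid (j := j.val) (hj := by omega) rfl]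
      rfl
  rw [Nat.card_eq_one_iff_unique]
  refine ⟨⟨fun X Y => ?_⟩, inferInstance⟩
  induction X using Quot.ind with
  | mk R =>
  induction Y using Quot.ind with
  | mk R' => exact (all R).trans (all R').symm

end Closed

end Dunwoody

theorem theorem7 (a b c n : ℕ) (r s : ℤ) (hn : 0 < n) (hd : 0 < 2 * a + b + c) :
    let H := Dunwoody.closedDiagram a b c n r s hn hd
    (∀ T ∈ H.snd.reducingGraphs, H.removeEdges T ∈ H.Rd) ∧
    ∃ M : ℕ,
      IsGreatest {m : ℕ | ∃ T ∈ H.snd.reducingGraphs, ∃ R : (H.removeEdges T).Region,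
        m = (H.removeEdges T).regionVertexCount R + ∑ᶠ γ ∈ T.edgeSet, H.curveVertexCount γ} M ∧
      H.modifiedComplexity = (n : ℤ) * (2 * a + b + c : ℕ) - M := by
  obtain ⟨h, M, hM, hc⟩ := Dunwoody.Diagram.modifiedComplexity_eq
    (Dunwoody.card_piece_closedDiagram_fst a b c n r s hn hd)
  refine ⟨h, M, hM, ?_⟩
  rw [hc, Dunwoody.complexity_closedDiagram, Nat.cast_mul]
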